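/- **Setting.** Data types are built from unit, integers, products, tagged unions, lists and binary trees. The *size* of a value is its number of scalars and constructors; a quantity attached to a value is *pseudo-polynomial* if it is at most $P(n,w)$ for a fixed polynomial $P$, where $n$ is the size of the value and $w$ the largest absolute value of an integer in it. Expressions are built from an input variable, temporary variables, constants, and black-box operators applied to expressions and $\lambda$-abstractions; statements are built from skip, sequencing, if, foreach over a list, and collect, so that a program denotes a set-valued function. A run is charged one step per evaluated construct, plus, for each operator application, the operator's own steps, the steps of the $\lambda$-arguments it calls, and the size of its output. Let $\mathsf F$ be a polynomial functor built from the identity, unit and integers by $\times$ and $+$; let $\phi:\mathsf FA\to\mathsf PA$, $\psi:B\to\mathsf P\mathsf FB$ be programs and $o:A\to\mathbb Z$ an objective function. The hylomorphism $h=[\![\phi,\psi]\!]_{\mathsf F}:B\to \mathsf PA$ maps a *state* $s$ to its set of *partial solutions*: all elements of $\phi(u)$, where $u$ arises from some $t\in\psi(s)$ by replacing each substate $s'$ in $t$ with an element of $h(s')$. The input program $(h,o)$ maps an instance $i\in B$ to the largest value of $o$ on $h(i)$. Let $G$ be a grammar (a set of expressions) and $I\subseteq B$ a set of instances. The search tree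 of $i$ has root $i$, and the children of $s$ are the substates occurring in $\psi(s)$. **Synthesis.** A program is synthesized by MetHyl from $(h,o)$, $G$ and $I$ if it results from the following steps, for any choice of synthesized fragments that meets the stated specifications. 1. *Thinning.* Choose finitely many comparisons $R=\{(op_j,k_j)\}$, $op_j\in\{\le,=\}$, containing $(\le,o)$ and with all other keys $k_j:A\to\mathbb Z$ in $G$; write $a\mathrel Rb$ if $k_j(a)\;op_j\;k_j(b)$ for all $j$. For $i\in I$ and every state $s$ in the search tree of $i$, if partial solutions $p_1,\dots,p_m$ of children of $s$ are replaced with $p_j'$ of the same children such that $p_j\mathrel Rp_j'$ for all $j$, then each partial solution of $s$ constructed from the $p_j$ must be $R$-below one constructed from the $p_j'$. The results of each recursive invocation are then thinned: only $R$-maximal elements are kept, one per $R$-equivalence class. 2. *New representation of partial solutions*, if $A$ contains lists or trees (otherwise nothing changes). A converting program $f_p\in G$ maps $A$ to tuples of scalars. By structural recursion on $\phi$, the minimal scalar-tuple-valued subexpressions enclosing occurrences of the input (*queries*) and the collected expressions (*constructors*) are extracted; they, the keys in $R$, and $o$ are replaced with programs in $G$ on the new representation (taking the temporary variables as further inputs),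 such that, on all inputs on which they are invoked in the run of the thinned program on instances of $I$, replaced queries, keys and objective return the same values, and replaced constructors return the $f_p$-image of the original value. 3. *Memoization.* Choose finitely many key functions $B\to\mathbb Z$ in $G$ such that any two states in the search tree of one $i\in I$ with the same keys have the same result; the recursion is memoized with the tuple of keys as key. 4. *New representation of states*, if $B$ contains lists or trees (otherwise nothing changes). As in Step 2, with a converting program $f_s\in G$ from $B$ to tuples of scalars, for the queries and collected transitions of $\psi$ and the key functions, on the inputs on which they are invoked in the run of the memoized program on instances of $I$; in a collected transition, each substate, decision value and tag is computed by a program in $G$. On an instance $i$ the resulting program converts $i$ by $f_s$ (if Step 4 was performed), runs the memoized, thinned recursion (thinning by successive insertion with pairwise comparison of keys, and memoization by linear search), and returns the largest objective value. **Theorem.** Assume that the recursion of $h$ terminates on every $i\in I$, and that 1. $\phi$, $\psi$ and all programs in $G$ run in pseudo-polynomial time in their own inputs, and so does $o$ if $A$ contains no list or tree (so that $o$ is kept); 2. for $i\in I$, all values generated while $h$ is run on $i$ (values of evaluated expressions and of temporary variables) have sizes and absolute values that are pseudo-polynomial in $i$; 3. all operators occurring in programs of $G$ are linear: there is a constant $c$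 such that all integers in the output have absolute value at most $c$ times $1$ plus the sum of the sizes and of the absolute values of the integers in the inputs. (An operator with its $\lambda$-arguments counts as one operator, with the variables in scope as additional inputs; $c$ may depend on it and on the place where it occurs.) Then every program synthesized by MetHyl from $(h,o)$, $G$ and $I$ runs in pseudo-polynomial time on $I$: there is a polynomial $P$ such that on each $i\in I$ it terminates within $P(n,w)$ steps, where $n$ is the size of $i$ and $w$ the largest absolute value in $i$. -/

import Mathlib

namespace MetHyl

/-! ## Types, values, sizes -/

/-- Data types: scalars, tuples, tagged unions, and the recursive data structures
(lists and binary trees, nested arbitrarily). -/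
inductive Ty : Type
  | unit : Ty
  | int : Ty
  | prod (a b : Ty) : Ty
  | sum (a b : Ty) : Ty
  | list (a : Ty) : Ty
  | tree (a : Ty) : Ty

/-- The values of a type. -/
@[reducible]
def Ty.El : Ty → Type
  | .unit => Unit
  | .int => ℤ
  | .prod a b => a.El × b.El
  | .sum a b => a.El ⊕ b.El
  | .list a => List a.El
  | .tree a => BinaryTree a.El

/-- Tuples of scalar values. -/
def Ty.isScalar : Ty → Bool
  | .unit => true
  | .int => true
  | .prod a b => a.isScalar && b.isScalar
  | _ => false

/-- Types in which no recursive data structure occurs. -/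
def Ty.isFlat : Ty → Bool
  | .unit => true
  | .int => true
  | .prod a b => a.isFlat && b.isFlat
  | .sum a b => a.isFlat && b.isFlat
  | _ => false

def treeToList {α : Type} : BinaryTree α → List α
  | .nil => []
  | .node a l r => treeToList l ++ a :: treeToList r

/-- All integers stored in a value. -/
def scalars : (τ : Ty) → τ.El → List ℤ
  | .unit, _ => []
  | .int, z => [z]
  | .prod a b, x => scalars a x.1 ++ scalars b x.2
  | .sum a b, x => Sum.elim (scalars a) (scalars b) x
  | .list a, l => l.flatMap (scalars a)
  | .tree a, t => (treeToList t).flatMap (scalars a)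

/-- The size of a value: its number of scalars and of constructors of unions, lists and trees. -/
def size : (τ : Ty) → τ.El → ℕ
  | .unit, _ => 1
  | .int, _ => 1
  | .prod a b, x => size a x.1 + size b x.2
  | .sum a b, x => Sum.elim (size a) (size b) x + 1
  | .list a, l => (l.map (size a)).sum + 1
  | .tree a, t => ((treeToList t).map (size a)).sum + 1

/-- The largest absolute value in a list of integers. -/
def absMax (l : List ℤ) : ℕ := (l.map Int.natAbs).foldr max 0

/-- The sum of the absolute values in a list of integers. -/
def absSum (l : List ℤ) : ℕ := (l.map Int.natAbs).sum

/-- The largest absolute value of an integer stored in a value. -/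
def mag (τ : Ty) (x : τ.El) : ℕ := absMax (scalars τ x)

/-- Values of the variables in a context. -/
@[reducible]
def Env : List Ty → Type
  | [] => Unit
  | τ :: Γ => τ.El × Env Γ

namespace Env

def append : {Δ Γ : List Ty} → Env Δ → Env Γ → Env (Δ ++ Γ)
  | [], _, _, t => t
  | _ :: _, _, d, t => (d.1, append d.2 t)

def scalars : {Γ : List Ty} → Env Γ → List ℤ
  | [], _ => []
  | τ :: _, t => MetHyl.scalars τ t.1 ++ scalars t.2

def size : {Γ : List Ty} → Env Γ → ℕ
  | [], _ => 0
  | τ :: _, t => MetHyl.size τ t.1 + size t.2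

end Env

/-- `T` is bounded by a polynomial in `n` and `w` (with natural coefficients, independent of
the argument). Applied with `n` the size of an input and `w` its largest absolute value, this is
a pseudo-polynomial bound. -/
def PolyBounded {α : Type} (T n w : α → ℕ) : Prop :=
  ∃ c k : ℕ, ∀ a, T a ≤ c * (n a + w a + 1) ^ k

/-! ## The language: operators, expressions, statements -/

/-- Variables of a context, as de Bruijn indices. -/
inductive Var : List Ty → Ty → Type
  | head {Γ : List Ty} {τ : Ty} : Var (τ :: Γ) τ
  | tail {Γ : List Ty} {τ τ' : Ty} : Var Γ τ → Var (τ' :: Γ) τ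

def Var.get : {Γ : List Ty} → {τ : Ty} → Var Γ τ → Env Γ → τ.El
  | _, _, .head, t => t.1
  | _, _, .tail v, t => v.get t.2

/-- What a black-box operator does with its functional arguments, the `j`-th of which takes
arguments of the types `(L j).1` and returns a value of type `(L j).2`: it may call them finitely
often, adaptively, and then returns a value. Operators without functional arguments just return. -/
inductive Comp {n : ℕ} (L : Fin n → List Ty × Ty) (ρ : Ty) : Type
  | ret (v : ρ.El) : Comp L ρ
  | call (j : Fin n) (xs : Env (L j).1) (k : (L j).2.El → Comp L ρ) : Comp L ρ

/-- Result of a computation, and the number of steps spent in the functional arguments, when the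
latter are given by `h`. -/
def Comp.run {n : ℕ} {L : Fin n → List Ty × Ty} {ρ : Ty}
    (h : ∀ j, Env (L j).1 → (L j).2.El × ℕ) : Comp L ρ → ρ.El × ℕ
  | .ret v => (v, 0)
  | .call j xs k =>
      let y := h j xs
      let r := Comp.run h (k y.1)
      (r.1, y.2 + r.2 + 1)

/-- The calls of functional arguments made by a computation. -/
def Comp.calls {n : ℕ} {L : Fin n → List Ty × Ty} {ρ : Ty}
    (h : ∀ j, Env (L j).1 → (L j).2.El × ℕ) : Comp L ρ → Set ((j : Fin n) × Env (L j).1)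
  | .ret _ => ∅
  | .call j xs k => {⟨j, xs⟩} ∪ Comp.calls h (k (h j xs).1)

/-- Black-box operators: arbitrary functions, with arbitrary numbers of steps. There are `m`
operands of types `a` and `n` functional arguments of types `L`. -/
structure Op {m n : ℕ} (a : Fin m → Ty) (L : Fin n → List Ty × Ty) (ρ : Ty) : Type where
  sem : (∀ j, (a j).El) → Comp L ρ
  cost : (∀ j, (a j).El) → ℕ

/-- Expressions of type `τ` with one distinguished input variable `inp` of type `σ` (the parameter
of the program) and temporary variables `Γ`. Lambda abstractions are the functional arguments
`lams` of operators. -/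
inductive Expr (σ : Ty) : List Ty → Ty → Type
  | inp {Γ : List Ty} : Expr σ Γ σ
  | tmp {Γ : List Ty} {τ : Ty} (v : Var Γ τ) : Expr σ Γ τ
  | const {Γ : List Ty} {τ : Ty} (v : τ.El) : Expr σ Γ τ
  | op {Γ : List Ty} {τ : Ty} {m n : ℕ} {a : Fin m → Ty} {L : Fin n → List Ty × Ty}
      (f : Op a L τ) (args : ∀ j, Expr σ Γ (a j))
      (lams : ∀ j, Expr σ ((L j).1 ++ Γ) (L j).2) : Expr σ Γ τ

/-- Value and number of steps of an expression. Operands are evaluated first; an operator costs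
its own steps, the steps of the calls it makes, and the steps to write down its output. -/
def Expr.eval {σ : Ty} (x : σ.El) : {Γ : List Ty} → {τ : Ty} → Expr σ Γ τ → Env Γ → τ.El × ℕ
  | _, _, .inp, _ => (x, 1)
  | _, _, .tmp v, t => (v.get t, 1)
  | _, _, .const v, _ => (v, 1)
  | _, τ, .op f args lams, t =>
      let vs := fun j => (Expr.eval x (args j) t).1
      let r := (f.sem vs).run fun j xs => Expr.eval x (lams j) (xs.append t)
      (r.1, (∑ j, (Expr.eval x (args j) t).2) + f.cost vs + r.2 + size τ r.1 + 1)

/-- Value of an expression. -/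
def Expr.val {σ τ : Ty} {Γ : List Ty} (e : Expr σ Γ τ) (x : σ.El) (t : Env Γ) : τ.El :=
  (e.eval x t).1

/-- Number of steps of an expression. -/
def Expr.cost {σ τ : Ty} {Γ : List Ty} (e : Expr σ Γ τ) (x : σ.El) (t : Env Γ) : ℕ :=
  (e.eval x t).2

/-- Statements with a parameter of type `σ` that collect values of type `ρ`. -/
inductive Stmt (σ ρ : Ty) : List Ty → Type
  | skip {Γ : List Ty} : Stmt σ ρ Γ
  | seq {Γ : List Ty} (s₁ s₂ : Stmt σ ρ Γ) : Stmt σ ρ Γ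
  | ite {Γ : List Ty} (e : Expr σ Γ .int) (s₁ s₂ : Stmt σ ρ Γ) : Stmt σ ρ Γ
  | collect {Γ : List Ty} (e : Expr σ Γ ρ) : Stmt σ ρ Γ
  | foreach {Γ : List Ty} {τ : Ty} (e : Expr σ Γ (.list τ)) (body : Stmt σ ρ (τ :: Γ)) :
      Stmt σ ρ Γ

/-- The collected values, in the order of their collection, and the number of steps. -/
def Stmt.eval {σ ρ : Ty} (x : σ.El) : {Γ : List Ty} → Stmt σ ρ Γ → Env Γ → List ρ.El × ℕ
  | _, .skip, _ => ([], 1)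
  | _, .seq s₁ s₂, t =>
      ((s₁.eval x t).1 ++ (s₂.eval x t).1, (s₁.eval x t).2 + (s₂.eval x t).2 + 1)
  | _, .ite e s₁ s₂, t =>
      let r := if e.val x t ≠ 0 then s₁.eval x t else s₂.eval x t
      (r.1, e.cost x t + r.2 + 1)
  | _, .collect e, t => ([e.val x t], e.cost x t + 1)
  | _, .foreach e body, t =>
      let rs := (e.val x t).map fun y => body.eval x (y, t)
      (rs.flatMap Prod.fst, e.cost x t + (rs.map fun r => r.2 + 1).sum + 1)

/-- The set-valued arrow denoted by a program, with the elements listed in order of collection. -/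
def Stmt.out {σ ρ : Ty} (s : Stmt σ ρ []) (x : σ.El) : List ρ.El := (s.eval x ()).1

def Stmt.cost {σ ρ : Ty} (s : Stmt σ ρ []) (x : σ.El) : ℕ := (s.eval x ()).2

/-! ### Recording what is evaluated during a run -/

/-- An expression together with the values of the temporary variables. -/
structure Point (σ : Ty) : Type where
  {Γ : List Ty}
  {τ : Ty}
  e : Expr σ Γ τ
  t : Env Γ

/-- The (sub)expressions, with the values of their temporary variables, that are evaluated while
`e` is evaluated; the inside of expressions satisfying `cut` is not inspected. -/
def Expr.trace {σ : Ty} (cut : ∀ ⦃Γ : List Ty⦄ ⦃τ : Ty⦄, Expr σ Γ τ → Prop) (x : σ.El) :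
    {Γ : List Ty} → {τ : Ty} → Expr σ Γ τ → Env Γ → Set (Point σ)
  | _, _, .inp, t => {⟨.inp, t⟩}
  | _, _, .tmp v, t => {⟨.tmp v, t⟩}
  | _, _, .const v, t => {⟨.const v, t⟩}
  | _, _, .op f args lams, t =>
      {⟨.op f args lams, t⟩} ∪
      {p | ¬ cut (.op f args lams) ∧
        ((∃ j, p ∈ Expr.trace cut x (args j) t) ∨
          ∃ c ∈ (f.sem fun j => (args j).val x t).calls
              (fun j xs => (lams j).eval x (xs.append t)),
            p ∈ Expr.trace cut x (lams c.1) (c.2.append t))}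

/-- The conditions and loop ranges evaluated by a statement. -/
def Stmt.tests {σ ρ : Ty} (x : σ.El) : {Γ : List Ty} → Stmt σ ρ Γ → Env Γ → Set (Point σ)
  | _, .skip, _ => ∅
  | _, .seq s₁ s₂, t => s₁.tests x t ∪ s₂.tests x t
  | _, .ite e s₁ s₂, t =>
      {⟨e, t⟩} ∪ {p | if e.val x t ≠ 0 then p ∈ s₁.tests x t else p ∈ s₂.tests x t}
  | _, .collect _, _ => ∅
  | _, .foreach e body, t => {⟨e, t⟩} ∪ {p | ∃ y ∈ e.val x t, p ∈ body.tests x (y, t)}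

/-- The collected expressions evaluated by a statement. -/
def Stmt.collects {σ ρ : Ty} (x : σ.El) :
    {Γ : List Ty} → Stmt σ ρ Γ → Env Γ → Set ((Γ' : List Ty) × Expr σ Γ' ρ × Env Γ')
  | _, .skip, _ => ∅
  | _, .seq s₁ s₂, t => s₁.collects x t ∪ s₂.collects x t
  | _, .ite e s₁ s₂, t =>
      {p | if e.val x t ≠ 0 then p ∈ s₁.collects x t else p ∈ s₂.collects x t}
  | Γ, .collect e, t => {⟨Γ, e, t⟩}
  | _, .foreach e body, t => {p | ∃ y ∈ e.val x t, p ∈ body.collects x (y, t)}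

/-- Everything that is evaluated when the program `s` is run on `x`. -/
def Stmt.evaluated {σ ρ : Ty} (s : Stmt σ ρ []) (x : σ.El) : Set (Point σ) :=
  {p | (∃ q ∈ s.tests x (), p ∈ q.e.trace (fun _ _ _ => False) x q.t) ∨
    ∃ q ∈ s.collects x (), p ∈ q.2.1.trace (fun _ _ _ => False) x q.2.2}

/-! ## Polynomial functors, recursive generators, hylomorphisms -/

/-- The polynomial functors of the language. -/
inductive Func : Type
  | id : Func
  | unit : Func
  | int : Func
  | prod (F G : Func) : Func
  | sum (F G : Func) : Func

namespace Func

/-- Action on types. -/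
@[reducible]
def app : Func → Ty → Ty
  | .id, a => a
  | .unit, _ => .unit
  | .int, _ => .int
  | .prod F G, a => .prod (F.app a) (G.app a)
  | .sum F G, a => .sum (F.app a) (G.app a)

/-- Action on functions. -/
def map {a b : Ty} (f : a.El → b.El) : (F : Func) → (F.app a).El → (F.app b).El
  | .id, x => f x
  | .unit, x => x
  | .int, x => x
  | .prod F G, x => (map f F x.1, map f G x.2)
  | .sum F G, x => Sum.map (map f F) (map f G) x

/-- Action on effectful functions, from left to right. -/
def traverse {m : Type → Type} [Monad m] {a b : Ty} (f : a.El → m b.El) :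
    (F : Func) → (F.app a).El → m (F.app b).El
  | .id, x => f x
  | .unit, x => pure x
  | .int, x => pure x
  | .prod F G, x => do
      let y ← traverse f F x.1
      let z ← traverse f G x.2
      pure (y, z)
  | .sum F _, .inl x => do
      let y ← traverse f F x
      pure (.inl y)
  | .sum _ G, .inr x => do
      let y ← traverse f G x
      pure (.inr y)

/-- `car`, from structures of collections to collections of structures. -/
def car {a : Ty} : (F : Func) → (F.app (.list a)).El → List (F.app a).El
  | .id, x => x
  | .unit, x => [x]
  | .int, x => [x]
  | .prod F G, x => (car F x.1).product (car G x.2)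
  | .sum F _, .inl x => (car F x).map .inl
  | .sum _ G, .inr x => (car G x).map .inr

/-- The components at the positions of the identity functor. -/
def comps {a : Ty} : (F : Func) → (F.app a).El → List a.El
  | .id, x => [x]
  | .unit, _ => []
  | .int, _ => []
  | .prod F G, x => comps F x.1 ++ comps G x.2
  | .sum F G, x => Sum.elim (comps F) (comps G) x

/-- The pairs of corresponding components of two structures of the same shape. -/
def zip {a b : Ty} : (F : Func) → (F.app a).El → (F.app b).El → Option (List (a.El × b.El))
  | .id, x, y => some [(x, y)]
  | .unit, _, _ => some []
  | .int, x, y => if x = y then some [] else none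
  | .prod F G, x, y => do
      let l ← zip F x.1 y.1
      let l' ← zip G x.2 y.2
      pure (l ++ l')
  | .sum F _, .inl x, .inl y => zip F x y
  | .sum _ G, .inr x, .inr y => zip G x y
  | .sum _ _, _, _ => none

end Func

/-- The recursive generator `rg (post ∘ cup ∘ P phi, psi)`: `rg n s` is its result on `s` if the
recursion from `s` is less than `n` deep, and `none` otherwise. So where the recursion terminates,
the values `some _` give the smallest (and only) solution of the defining equation
`r = post ∘ cup ∘ P phi ∘ cup ∘ P (car ∘ F r) ∘ psi`. -/
def rg {A B : Ty} (F : Func) (post : List A.El → List A.El)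
    (phi : (F.app A).El → List A.El) (psi : B.El → List (F.app B).El) :
    ℕ → B.El → Option (List A.El)
  | 0, _ => none
  | n + 1, s => do
      let Ls ← (psi s).mapM fun t => F.traverse (b := .list A) (rg F post phi psi n) t
      pure (post ((Ls.flatMap (F.car (a := A))).flatMap phi))

/-- The structures of partial solutions on which `phi` is invoked, in the invocation of the
recursive generator on `s`. -/
def phiInputs {A B : Ty} (F : Func) (post : List A.El → List A.El)
    (phi : (F.app A).El → List A.El) (psi : B.El → List (F.app B).El) (s : B.El) :
    Set (F.app A).El :=
  {u | ∃ t ∈ psi s, ∃ n T,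
    F.traverse (b := .list A) (rg F post phi psi n) t = some T ∧ u ∈ F.car (a := A) T}

/-- `s'` is a direct child of `s` in the search tree. -/
def Child {B : Ty} (F : Func) (psi : B.El → List (F.app B).El) (s s' : B.El) : Prop :=
  ∃ t ∈ psi s, s' ∈ F.comps t

/-- The states of the search tree of `i`. -/
def states {B : Ty} (F : Func) (psi : B.El → List (F.app B).El) (i : B.El) : Set B.El :=
  {s | Relation.ReflTransGen (Child F psi) i s}

/-- The relational hylomorphism of `phi` and `psi`, as a recursive generator. -/
def hylo {A B : Ty} (F : Func) (φ : Stmt (F.app A) A []) (ψ : Stmt B (F.app B) []) :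
    ℕ → B.El → Option (List A.El) :=
  rg F id φ.out ψ.out

/-- The partial solutions of `s`: the value of the hylomorphism. -/
def solutions {A B : Ty} (F : Func) (φ : Stmt (F.app A) A []) (ψ : Stmt B (F.app B) [])
    (s : B.El) : Set A.El :=
  {p | ∃ n L, hylo F φ ψ n s = some L ∧ p ∈ L}

/-! ## Keyword preorders and thinning -/

/-- A comparison: a key function together with `≤` (if `le` is true) or `=`. -/
structure Cmp (A : Ty) : Type where
  le : Bool
  key : Expr A [] .int

def Cmp.holds {A : Ty} (c : Cmp A) (p q : A.El) : Bool :=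
  if c.le then decide (c.key.val p () ≤ c.key.val q ())
  else decide (c.key.val p () = c.key.val q ())

/-- The keyword preorder of a collection of comparisons. -/
def dominated {A : Ty} (R : List (Cmp A)) (p q : A.El) : Bool := R.all fun c => c.holds p q

def keyVec {A : Ty} (R : List (Cmp A)) (p : A.El) : List ℤ := R.map fun c => c.key.val p ()

/-- An implementation of `thin R`: the elements are inserted one by one in the list of the
currently maximal ones, which is kept free of `R`-equivalent elements and in the lexicographic
order of the key vectors. The second component is the number of steps: the keys of each element
are evaluated once, and each insertion scans the current list, comparing key vectors, at most
three times (is the new element dominated, which ones does it dominate, where does it belong). -/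
def thin {A : Ty} (R : List (Cmp A)) : List A.El → List A.El × ℕ
  | [] => ([], 1)
  | p :: ps =>
      let r := thin R ps
      (if r.1.any fun q => dominated R p q then r.1
        else (r.1.filter fun q => !dominated R q p).orderedInsert
          (fun a b => keyVec R a ≤ keyVec R b) p,
       r.2 + (R.map fun c => c.key.cost p ()).sum + 3 * (r.1.length + 1) * (R.length + 1))

/-! ## Memoized programs and their execution -/

/-- A program `(rg (thin cmps ∘ cup ∘ P phi, psi) memoized by keys, obj)`. -/
structure Prog (F : Func) (B A : Ty) : Type where
  psi : Stmt B (F.app B) []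
  phi : Stmt (F.app A) A []
  cmps : List (Cmp A)
  obj : Expr A [] .int
  keys : List (Expr B [] .int)

/-- A record of the memoization buffer: the key and the stored result, and also the state for
which the result was computed (which the execution does not use). -/
structure Entry (B A : Ty) : Type where
  state : B.El
  key : List ℤ
  result : List A.El

/-- Computations that may fail to terminate, with a buffer and a step counter. -/
abbrev Exec (B A : Ty) : Type → Type := StateT (List (Entry B A) × ℕ) Option

def tick {B A : Ty} (n : ℕ) : Exec B A Unit := modify fun st => (st.1, st.2 + n)

/-- The memoized recursive generator, with recursion depth less than the first argument. Buffer
look-up is a linear search; a later record for the same key replaces an earlier one. -/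
def Prog.exec {F : Func} {B A : Ty} (P : Prog F B A) : ℕ → B.El → Exec B A (List A.El)
  | 0, _ => failure
  | n + 1, s => do
      let key := P.keys.map fun k => k.val s ()
      tick (1 + (P.keys.map fun k => k.cost s ()).sum)
      let st ← get
      tick ((st.1.length + 1) * (P.keys.length + 1))
      match st.1.find? fun e => e.key = key with
      | some e => pure e.result
      | none => do
          tick (P.psi.cost s)
          let Ls ← (P.psi.out s).mapM fun t => F.traverse (b := .list A) (P.exec n) t
          let us := Ls.flatMap (F.car (a := A))
          tick (us.map fun u => size (F.app A) u + P.phi.cost u).sum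
          let r := thin P.cmps (us.flatMap P.phi.out)
          tick r.2
          modify fun st => (⟨s, key, r.1⟩ :: st.1, st.2 + 1)
          pure r.1

/-- The states for which a result is computed (so on which `psi` is run) in the run on `i`. -/
def Prog.expanded {F : Func} {B A : Ty} (P : Prog F B A) (i : B.El) : Set B.El :=
  {s | ∃ n L st, P.exec n i ([], 0) = some (L, st) ∧ ∃ e ∈ st.1, e.state = s}

/-- The states on which the memoized generator is invoked in the run on `i`. -/
def Prog.invoked {F : Func} {B A : Ty} (P : Prog F B A) (i : B.El) : Set B.El :=
  {s | s = i ∨ ∃ s₀ ∈ P.expanded i, Child F P.psi.out s₀ s}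

/-! ## The synthesis steps -/

/-- The programs that may be synthesized. -/
abbrev Grammar : Type := ∀ ⦃σ : Ty⦄ ⦃Γ : List Ty⦄ ⦃τ : Ty⦄, Expr σ Γ τ → Prop

/-- The input variable occurs in the expression outside of all queries, so that the expression has
to be a part of a query. -/
def Expr.stuck {σ : Ty} : {Γ : List Ty} → {τ : Ty} → Expr σ Γ τ → Bool
  | _, _, .inp => true
  | _, _, .tmp _ => false
  | _, _, .const _ => false
  | _, τ, .op _ args lams =>
      !τ.isScalar && (decide (∃ j, (args j).stuck = true) || decide (∃ j, (lams j).stuck = true))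

/-- The expression is extracted as a query: it returns a tuple of scalar values and has an
immediate subexpression in which the input variable occurs outside of all queries. -/
def Expr.isQuery {σ : Ty} {Γ : List Ty} {τ : Ty} : Expr σ Γ τ → Bool
  | .op _ args lams =>
      τ.isScalar && (decide (∃ j, (args j).stuck = true) || decide (∃ j, (lams j).stuck = true))
  | _ => false

/-- Rewriting of an expression: each query `e` is replaced with `q e`, which is applied to the new
representation of the input and to the temporary variables. (The case of `inp` is not used, as
stuck expressions are not rewritten.) -/
def Expr.rewrite {σ σ' : Ty} (q : ∀ ⦃Γ : List Ty⦄ ⦃τ : Ty⦄, Expr σ Γ τ → Expr σ' Γ τ) :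
    {Γ : List Ty} → {τ : Ty} → Expr σ Γ τ → Expr σ' Γ τ
  | _, _, .inp => q .inp
  | _, _, .tmp v => .tmp v
  | _, _, .const v => .const v
  | _, _, .op f args lams =>
      if (Expr.op f args lams).isQuery then q (.op f args lams)
      else .op f (fun j => (args j).rewrite q) (fun j => (lams j).rewrite q)

/-- The rewriting succeeds, and all queries are replaced with programs satisfying `Q`. -/
def Expr.RewriteOK {σ σ' : Ty} (q : ∀ ⦃Γ : List Ty⦄ ⦃τ : Ty⦄, Expr σ Γ τ → Expr σ' Γ τ)
    (Q : ∀ ⦃Γ : List Ty⦄ ⦃τ : Ty⦄, Expr σ' Γ τ → Prop) :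
    {Γ : List Ty} → {τ : Ty} → Expr σ Γ τ → Prop
  | _, _, .inp => False
  | _, _, .tmp _ => True
  | _, _, .const _ => True
  | _, _, .op f args lams =>
      if (Expr.op f args lams).isQuery then Q (q (.op f args lams))
      else (∀ j, (args j).RewriteOK q Q) ∧ ∀ j, (lams j).RewriteOK q Q

/-- Rewriting of a statement: queries `e` are replaced with `q e`, and each constructor, i.e. each
collected expression `e`, with `c e`. -/
def Stmt.rewrite {σ σ' ρ ρ' : Ty} (q : ∀ ⦃Γ : List Ty⦄ ⦃τ : Ty⦄, Expr σ Γ τ → Expr σ' Γ τ)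
    (c : ∀ ⦃Γ : List Ty⦄, Expr σ Γ ρ → Expr σ' Γ ρ') :
    {Γ : List Ty} → Stmt σ ρ Γ → Stmt σ' ρ' Γ
  | _, .skip => .skip
  | _, .seq s₁ s₂ => .seq (s₁.rewrite q c) (s₂.rewrite q c)
  | _, .ite e s₁ s₂ => .ite (e.rewrite q) (s₁.rewrite q c) (s₂.rewrite q c)
  | _, .collect e => .collect (c e)
  | _, .foreach e body => .foreach (e.rewrite q) (body.rewrite q c)

/-- The rewriting succeeds, with queries replaced with programs satisfying `Q` and constructors
with programs satisfying `C`. -/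
def Stmt.RewriteOK {σ σ' ρ ρ' : Ty} (q : ∀ ⦃Γ : List Ty⦄ ⦃τ : Ty⦄, Expr σ Γ τ → Expr σ' Γ τ)
    (c : ∀ ⦃Γ : List Ty⦄, Expr σ Γ ρ → Expr σ' Γ ρ')
    (Q : ∀ ⦃Γ : List Ty⦄ ⦃τ : Ty⦄, Expr σ' Γ τ → Prop)
    (C : ∀ ⦃Γ : List Ty⦄, Expr σ' Γ ρ' → Prop) :
    {Γ : List Ty} → Stmt σ ρ Γ → Prop
  | _, .skip => True
  | _, .seq s₁ s₂ => s₁.RewriteOK q c Q C ∧ s₂.RewriteOK q c Q C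
  | _, .ite e s₁ s₂ => e.RewriteOK q Q ∧ s₁.RewriteOK q c Q C ∧ s₂.RewriteOK q c Q C
  | _, .collect e => C (c e)
  | _, .foreach e body => e.RewriteOK q Q ∧ body.RewriteOK q c Q C

/-- The invocations of queries when the statement is run on `x`. -/
def Stmt.queryInputs {σ ρ : Ty} (s : Stmt σ ρ []) (x : σ.El) : Set (Point σ) :=
  {p | (∃ r ∈ s.tests x (), p ∈ r.e.trace (fun _ _ e => e.isQuery = true) x r.t) ∧
    p.e.isQuery = true}

/-- Specification of the replacements `q` of queries and `c` of constructors on the run on `x`,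
for the conversions `f` of inputs and `g` of outputs. -/
def Stmt.RewriteSpec {σ σ' ρ ρ' : Ty}
    (q : ∀ ⦃Γ : List Ty⦄ ⦃τ : Ty⦄, Expr σ Γ τ → Expr σ' Γ τ)
    (c : ∀ ⦃Γ : List Ty⦄, Expr σ Γ ρ → Expr σ' Γ ρ')
    (f : σ.El → σ'.El) (g : ρ.El → ρ'.El) (s : Stmt σ ρ []) (x : σ.El) : Prop :=
  (∀ p ∈ s.queryInputs x, p.e.val x p.t = (q p.e).val (f x) p.t) ∧
  ∀ p ∈ s.collects x (), g (p.2.1.val x p.2.2) = (c p.2.1).val (f x) p.2.2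

section

variable {F : Func} {A B : Ty}

/-- `p` can be constructed in the invocation on `s` from the partial solutions `l.2`, taken from
the substates `l.1`. -/
def Constructs (φ : Stmt (F.app A) A []) (ψ : Stmt B (F.app B) []) (s : B.El)
    (l : List (B.El × A.El)) (p : A.El) : Prop :=
  ∃ t ∈ ψ.out s, ∃ u, F.zip t u = some l ∧ p ∈ φ.out u

/-- The preorder has no counterexample on the instance `i`: partial solutions constructed from
dominated ones are dominated. -/
def NoCounterexample (φ : Stmt (F.app A) A []) (ψ : Stmt B (F.app B) []) (R : List (Cmp A))
    (i : B.El) : Prop :=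
  ∀ s ∈ states F ψ.out i, ∀ l : List (B.El × A.El × A.El),
    (∀ y ∈ l, Child F ψ.out s y.1 ∧ y.2.1 ∈ solutions F φ ψ y.1 ∧ y.2.2 ∈ solutions F φ ψ y.1 ∧
      dominated R y.2.1 y.2.2 = true) →
    ∀ p₁, Constructs φ ψ s (l.map fun y => (y.1, y.2.1)) p₁ →
      ∃ p₂, Constructs φ ψ s (l.map fun y => (y.1, y.2.2)) p₂ ∧ dominated R p₁ p₂ = true

/-- Step 1 (thinning): a keyword preorder that contains `(≤, o)`, whose other keys are in the
grammar, and without counterexamples. -/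
def Step1 (G : Grammar) (I : Set B.El) (φ : Stmt (F.app A) A []) (ψ : Stmt B (F.app B) [])
    (o : Expr A [] .int) (R : List (Cmp A)) : Prop :=
  ⟨true, o⟩ ∈ R ∧ (∀ c ∈ R, c = ⟨true, o⟩ ∨ G c.key) ∧ ∀ i ∈ I, NoCounterexample φ ψ R i

/-- Step 2 (incrementalization of partial solutions). If the partial solutions contain recursive
data structures, they are converted by a program `fp` of the grammar into tuples of scalars; the
queries and constructors in `φ`, the keys in `R` and the objective function are replaced with
programs of the grammar, such that the specification holds for their invocations in the run of the
thinned program on the instances. -/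
inductive Step2 (G : Grammar) (I : Set B.El) (φ : Stmt (F.app A) A [])
    (ψ : Stmt B (F.app B) []) (o : Expr A [] .int) (R : List (Cmp A)) :
    (A' : Ty) → Stmt (F.app A') A' [] → Expr A' [] .int → List (Cmp A') → Prop
  | skip (hA : A.isFlat = true) : Step2 G I φ ψ o R A φ o R
  | incr (hA : A.isFlat = false) (A' : Ty) (hA' : A'.isScalar = true)
      (fp : Expr A [] A') (hfp : G fp)
      (q : ∀ ⦃Γ : List Ty⦄ ⦃τ : Ty⦄, Expr (F.app A) Γ τ → Expr (F.app A') Γ τ)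
      (c : ∀ ⦃Γ : List Ty⦄, Expr (F.app A) Γ A → Expr (F.app A') Γ A')
      (k : Expr A [] .int → Expr A' [] .int)
      (hG : φ.RewriteOK q c (fun _ _ e => G e) (fun _ e => G e))
      (hk : ∀ y ∈ R, G (k y.key)) (ho : G (k o))
      (hspec : ∀ i ∈ I, ∀ s ∈ states F ψ.out i,
        ∀ u ∈ phiInputs F (fun S => (thin R S).1) φ.out ψ.out s,
          φ.RewriteSpec q c (F.map fun p => fp.val p ()) (fun p => fp.val p ()) u ∧
          ∀ p ∈ φ.out u, o.val p () = (k o).val (fp.val p ()) () ∧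
            ∀ y ∈ R, y.key.val p () = (k y.key).val (fp.val p ()) ()) :
      Step2 G I φ ψ o R A' (φ.rewrite q c) (k o) (R.map fun y => ⟨y.le, k y.key⟩)

/-- Step 3 (memoization): key functions from the grammar, such that any two states of a search tree
with the same keys have the same results. -/
def Step3 (G : Grammar) (I : Set B.El) (φ : Stmt (F.app A) A []) (ψ : Stmt B (F.app B) [])
    (R : List (Cmp A)) (K : List (Expr B [] .int)) : Prop :=
  (∀ k ∈ K, G k) ∧
  ∀ i ∈ I, ∀ s₁ ∈ states F ψ.out i, ∀ s₂ ∈ states F ψ.out i,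
    (∀ k ∈ K, k.val s₁ () = k.val s₂ ()) →
    ∀ n₁ n₂ L₁ L₂, rg F (fun S => (thin R S).1) φ.out ψ.out n₁ s₁ = some L₁ →
      rg F (fun S => (thin R S).1) φ.out ψ.out n₂ s₂ = some L₂ → ∀ p, p ∈ L₁ ↔ p ∈ L₂

end

/-! Assembling a transition from its components. -/

/-- Pairing, as an operator. -/
def pairOp (a b : Ty) : Op (m := 2) (n := 0) ![a, b] Fin.elim0 (.prod a b) where
  sem v := .ret (v 0, v 1)
  cost _ := 0

def inlOp (a b : Ty) : Op (m := 1) (n := 0) ![a] Fin.elim0 (.sum a b) where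
  sem v := .ret (.inl (v 0))
  cost _ := 0

def inrOp (a b : Ty) : Op (m := 1) (n := 0) ![b] Fin.elim0 (.sum a b) where
  sem v := .ret (.inr (v 0))
  cost _ := 0

/-- Conditional expressions, as an operator: the branches are functions without parameters. -/
def condOp (a : Ty) : Op (m := 1) (n := 2) ![.int] (fun _ => ([], a)) a where
  sem v :=
    let b : ℤ := v 0
    .call (if b ≠ 0 then 0 else 1) () fun y => .ret y
  cost _ := 0

def Expr.pair {σ a b : Ty} {Γ : List Ty} (e₁ : Expr σ Γ a) (e₂ : Expr σ Γ b) :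
    Expr σ Γ (.prod a b) :=
  .op (pairOp a b) (Fin.cons e₁ (Fin.cons e₂ (fun j => j.elim0))) (fun j => j.elim0)

def Expr.inl {σ a b : Ty} {Γ : List Ty} (e : Expr σ Γ a) : Expr σ Γ (.sum a b) :=
  .op (inlOp a b) (Fin.cons e (fun j => j.elim0)) (fun j => j.elim0)

def Expr.inr {σ a b : Ty} {Γ : List Ty} (e : Expr σ Γ b) : Expr σ Γ (.sum a b) :=
  .op (inrOp a b) (Fin.cons e (fun j => j.elim0)) (fun j => j.elim0)

def Expr.cond {σ a : Ty} {Γ : List Ty} (e : Expr σ Γ .int) (e₁ e₂ : Expr σ Γ a) : Expr σ Γ a :=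
  .op (condOp a) (Fin.cons e (fun j => j.elim0)) (Fin.cons e₁ (Fin.cons e₂ (fun j => j.elim0)))

/-- Expressions for transitions in which each substate is computed by a program of the grammar
(a constructor) and so is each decision value, including the tags of unions (the queries). -/
inductive Assembled (G : Grammar) {σ B : Ty} {Γ : List Ty} :
    (F : Func) → Expr σ Γ (F.app B) → Prop
  | id (e : Expr σ Γ B) : G e → Assembled G .id e
  | unit : Assembled G .unit (.const ())
  | int (e : Expr σ Γ .int) : G e → Assembled G .int e
  | prod (F₁ F₂ : Func) (e₁ : Expr σ Γ (F₁.app B)) (e₂ : Expr σ Γ (F₂.app B)) :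
      Assembled G F₁ e₁ → Assembled G F₂ e₂ → Assembled G (.prod F₁ F₂) (.pair e₁ e₂)
  | inl (F₁ F₂ : Func) (e : Expr σ Γ (F₁.app B)) :
      Assembled G F₁ e → Assembled G (.sum F₁ F₂) (.inl e)
  | inr (F₁ F₂ : Func) (e : Expr σ Γ (F₂.app B)) :
      Assembled G F₂ e → Assembled G (.sum F₁ F₂) (.inr e)
  | cond (F₁ F₂ : Func) (e : Expr σ Γ .int) (e₁ : Expr σ Γ (F₁.app B))
      (e₂ : Expr σ Γ (F₂.app B)) :
      G e → Assembled G F₁ e₁ → Assembled G F₂ e₂ →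
      Assembled G (.sum F₁ F₂) (.cond e (.inl e₁) (.inr e₂))

/-- Step 4 (incrementalization of states). If the states contain recursive data structures, they
are converted by a program `fs` of the grammar into tuples of scalars; the queries and constructors
in `ψ` and the key functions are replaced, such that the specification holds for their invocations
in the run of the memoized program on the instances. The last two indices are the resulting program
and the conversion that is applied to the instance. -/
inductive Step4 (G : Grammar) {F : Func} {B A : Ty} (I : Set B.El) (P : Prog F B A) :
    (B' : Ty) → Prog F B' A → Expr B [] B' → Prop
  | skip (hB : B.isFlat = true) : Step4 G I P B P .inp
  | incr (hB : B.isFlat = false) (B' : Ty) (hB' : B'.isScalar = true)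
      (fs : Expr B [] B') (hfs : G fs)
      (q : ∀ ⦃Γ : List Ty⦄ ⦃τ : Ty⦄, Expr B Γ τ → Expr B' Γ τ)
      (c : ∀ ⦃Γ : List Ty⦄, Expr B Γ (F.app B) → Expr B' Γ (F.app B'))
      (k : Expr B [] .int → Expr B' [] .int)
      (hG : P.psi.RewriteOK q c (fun _ _ e => G e) (fun _ e => Assembled G F e))
      (hk : ∀ y ∈ P.keys, G (k y))
      (hspec : ∀ i ∈ I,
        (∀ s ∈ P.expanded i,
          P.psi.RewriteSpec q c (fun s => fs.val s ()) (F.map fun s => fs.val s ()) s) ∧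
        ∀ s ∈ P.invoked i, ∀ y ∈ P.keys, y.val s () = (k y).val (fs.val s ()) ()) :
      Step4 G I P B'
        { psi := P.psi.rewrite q c, phi := P.phi, cmps := P.cmps, obj := P.obj,
          keys := P.keys.map k } fs

/-- The output of the synthesizer: a memoized program with its representations of states and
partial solutions, and the conversion of instances. -/
structure Output (F : Func) (B : Ty) : Type where
  B' : Ty
  A' : Ty
  prog : Prog F B' A'
  conv : Expr B [] B'

/-- `O` is synthesized from the program `(hylo φ ψ, o)`, for the grammar `G` and the instances
`I`, by the four steps. -/
def Synthesized (G : Grammar) {F : Func} {A B : Ty} (I : Set B.El) (φ : Stmt (F.app A) A [])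
    (ψ : Stmt B (F.app B) []) (o : Expr A [] .int) (O : Output F B) : Prop :=
  ∃ (R : List (Cmp A)) (φ' : Stmt (F.app O.A') O.A' []) (o' : Expr O.A' [] .int)
    (R' : List (Cmp O.A')) (K : List (Expr B [] .int)),
    Step1 G I φ ψ o R ∧ Step2 G I φ ψ o R O.A' φ' o' R' ∧ Step3 G I φ' ψ R' K ∧
    Step4 G I { psi := ψ, phi := φ', cmps := R', obj := o', keys := K } O.B' O.prog O.conv

/-- Running the output on an instance: convert the instance, run the memoized generator from the
empty buffer, and return the largest objective value. The result is this value (`none` if there is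
no solution) with the number of steps, or `none` if the recursion is not less than `n` deep. -/
def Output.run {F : Func} {B : Ty} (O : Output F B) (n : ℕ) (i : B.El) :
    Option (Option ℤ × ℕ) := do
  let r ← O.prog.exec n (O.conv.val i ()) ([], O.conv.cost i ())
  pure ((r.1.map fun p => O.prog.obj.val p ()).max?,
    r.2.2 + (r.1.map fun p => O.prog.obj.cost p () + 1).sum + 1)

/-- The output terminates on all instances of `I`, in a number of steps that is polynomial in the
size of the instance and the largest absolute value in it. -/
def Output.RunsInPseudoPolyTime {F : Func} {B : Ty} (O : Output F B) (I : Set B.El) : Prop :=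
  ∃ T : I → ℕ, PolyBounded T (fun i => size B i) (fun i => mag B i) ∧
    ∀ i : I, ∃ n v, O.run n i = some (v, T i)

/-! ## The assumptions -/

/-- The expression runs in pseudo-polynomial time (in the input and the temporary variables). -/
def Expr.PseudoPolyTime {σ τ : Ty} {Γ : List Ty} (e : Expr σ Γ τ) : Prop :=
  PolyBounded (fun y : σ.El × Env Γ => e.cost y.1 y.2)
    (fun y => size σ y.1 + y.2.size) (fun y => absMax (scalars σ y.1 ++ y.2.scalars))

/-- The statement runs in pseudo-polynomial time. -/
def Stmt.PseudoPolyTime {σ ρ : Ty} (s : Stmt σ ρ []) : Prop :=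
  PolyBounded (fun x : σ.El => s.cost x) (size σ) (mag σ)

/-- All operators in the expression are linear: for some constant `c`, each value in the output is
at most `c` times the sum of the values and sizes of the inputs. An operator together with its
functional arguments counts as one operator, whose inputs are its operands and the variables in
scope, which the functional arguments may capture. -/
def Expr.LinearOps {σ : Ty} : {Γ : List Ty} → {τ : Ty} → Expr σ Γ τ → Prop
  | _, _, .inp => True
  | _, _, .tmp _ => True
  | _, _, .const _ => True
  | Γ, τ, .op (a := a) f args lams =>
      (∃ c : ℕ, ∀ (x : σ.El) (t : Env Γ),
        mag τ ((Expr.op f args lams).val x t) ≤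
          c * (1 + (∑ j, (absSum (scalars (a j) ((args j).val x t)) +
                size (a j) ((args j).val x t))) +
            (absSum (scalars σ x) + size σ x) + (absSum t.scalars + t.size))) ∧
      (∀ j, (args j).LinearOps) ∧ ∀ j, (lams j).LinearOps

/-- All values generated when the hylomorphism is run on an instance in `I` (the values of all
expressions that are evaluated, and of the temporary variables) have sizes and absolute values that
are polynomial in the size of the instance and the largest absolute value in it. -/
def PseudoPolyValues {F : Func} {A B : Ty} (I : Set B.El) (φ : Stmt (F.app A) A [])
    (ψ : Stmt B (F.app B) []) : Prop :=
  ∃ b : I → ℕ, PolyBounded b (fun i => size B i) (fun i => mag B i) ∧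
    ∀ i : I, ∀ s ∈ states F ψ.out i,
      (∀ p ∈ ψ.evaluated s,
        size p.τ (p.e.val s p.t) + p.t.size ≤ b i ∧
        mag p.τ (p.e.val s p.t) ≤ b i ∧ absMax p.t.scalars ≤ b i) ∧
      ∀ u ∈ phiInputs F id φ.out ψ.out s, ∀ p ∈ φ.evaluated u,
        size p.τ (p.e.val u p.t) + p.t.size ≤ b i ∧
        mag p.τ (p.e.val u p.t) ≤ b i ∧ absMax p.t.scalars ≤ b i

end MetHyl

open MetHyl

/-!
The running time of a synthesized program is the number of recursive invocations that are really
executed, times the cost of one of them. Both are bounded with the help of one fact: after the two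
changes of representation, states and partial solutions live in types without lists and trees
(either they did before, or they are tuples of scalars now), and such a type has only polynomially
many values of bounded magnitude (`exists_polyGrowth_card_of_isFlat`). The magnitudes are
pseudo-polynomial: those of the original values by assumption, and those of the converted values
because the conversions are programs with linear operators (`Expr.PolyCost.exists_fits_val`).

*One invocation.* The lists produced by thinning are free of duplicates, so that they have
pseudo-polynomial length, and so have the lists of structures that are combined from them. Their
elements are images of results of the hylomorphism, since thinning only discards results
(`gen_subset`) and commutes with a conversion that preserves the keys (`gen_thin_map`). A rewritten
program makes the same calls on the same values as the original one, except for the queries and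
constructors, which have pseudo-polynomial cost; so its cost grows by a pseudo-polynomial factor
(`Stmt.RewriteOK.exists_cost_le`).

*Correctness of the buffer.* The specification of memoization identifies the results of two states
as sets. As thinned lists are in strictly increasing order of their key vectors, they are then equal
as lists (`thin_eq_of_mem_iff`), so that the memoized program returns exactly the results of the
program without memoization, and stays in the part of the input space where the replaced queries and
constructors are specified.

*The number of expansions.* A result is stored only when the recursion returns, so that states with
the same key can be expanded repeatedly while they are nested, and the number of keys does not bound
the number of expansions. The control flow, however, depends only on the current converted state and
on the set of keys in the buffer: it is a deterministic depth-first search (`Dfs`). No converted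
state is expanded twice with the same set of keys. If the second expansion were nested in the first,
the finite search below the state would contain a copy of itself; if it came later, the key of the
state would be in the buffer (`Dfs.pairwise_log`). The sets of keys form a chain, so that with `N`
converted states there are at most `N + 1` sets and `N * (N + 1)` expansions (`Dfs.length_log_le`).
The relation `Sim` carries this count, the results and the costs through the monadic execution.
-/

namespace MetHyl

/-! ### Polynomially bounded functions -/

/-- Monotone functions on the natural numbers that are bounded by a polynomial. Monotonicity makes
the class closed under composition. -/
def PolyGrowth (p : ℕ → ℕ) : Prop := Monotone p ∧ ∃ c k : ℕ, ∀ x, p x ≤ c * (x + 1) ^ k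

namespace PolyGrowth

theorem const (a : ℕ) : PolyGrowth fun _ => a :=
  ⟨monotone_const, a, 0, fun _ => by simp⟩

theorem id : PolyGrowth fun x => x :=
  ⟨monotone_id, 1, 1, fun _ => by simp⟩

theorem add {p q : ℕ → ℕ} (hp : PolyGrowth p) (hq : PolyGrowth q) :
    PolyGrowth fun x => p x + q x := by
  obtain ⟨mp, c, k, h⟩ := hp
  obtain ⟨mq, d, l, h'⟩ := hq
  refine ⟨mp.add mq, c + d, k + l, fun x => ?_⟩
  rw [add_mul]
  refine Nat.add_le_add ((h x).trans ?_) ((h' x).trans ?_)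
  · exact Nat.mul_le_mul_left _ (Nat.pow_le_pow_right (by omega) (by omega))
  · exact Nat.mul_le_mul_left _ (Nat.pow_le_pow_right (by omega) (by omega))

theorem mul {p q : ℕ → ℕ} (hp : PolyGrowth p) (hq : PolyGrowth q) :
    PolyGrowth fun x => p x * q x := by
  obtain ⟨mp, c, k, h⟩ := hp
  obtain ⟨mq, d, l, h'⟩ := hq
  refine ⟨mp.mul' mq, c * d, k + l, fun x => ?_⟩
  calc p x * q x ≤ (c * (x + 1) ^ k) * (d * (x + 1) ^ l) := Nat.mul_le_mul (h x) (h' x)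
    _ = _ := by ring

theorem pow {p : ℕ → ℕ} (hp : PolyGrowth p) (k : ℕ) : PolyGrowth fun x => p x ^ k := by
  induction k with
  | zero => simpa using const 1
  | succ k ih => simpa only [pow_succ] using ih.mul hp

theorem comp {p q : ℕ → ℕ} (hp : PolyGrowth p) (hq : PolyGrowth q) :
    PolyGrowth fun x => p (q x) := by
  obtain ⟨c, k, h⟩ := hp.2
  have h1 : PolyGrowth fun x => c * (q x + 1) ^ k := (const c).mul ((hq.add (const 1)).pow k)
  obtain ⟨d, l, h'⟩ := h1.2
  exact ⟨fun a b hab => hp.1 (hq.1 hab), d, l, fun x => (h _).trans (h' x)⟩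

theorem sum {ι : Type} (s : Finset ι) {p : ι → ℕ → ℕ} (h : ∀ j ∈ s, PolyGrowth (p j)) :
    PolyGrowth fun x => ∑ j ∈ s, p j x := by
  classical
  induction s using Finset.induction_on with
  | empty => simpa using const 0
  | insert a s ha ih =>
    simp only [Finset.sum_insert ha]
    exact (h a (by simp)).add (ih fun j hj => h j (by simp [hj]))

end PolyGrowth

/-! ### Bounds on sizes and absolute values -/

theorem absMax_le {l : List ℤ} {W : ℕ} : absMax l ≤ W ↔ ∀ z ∈ l, z.natAbs ≤ W := by
  induction l with
  | nil => simp [absMax]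
  | cons a l ih =>
    simp only [absMax, List.map_cons, List.foldr_cons, List.mem_cons, forall_eq_or_imp] at ih ⊢
    rw [max_le_iff, ih]

theorem absMax_append_le {l l' : List ℤ} {W : ℕ} :
    absMax (l ++ l') ≤ W ↔ absMax l ≤ W ∧ absMax l' ≤ W := by
  simp only [absMax_le, List.mem_append]
  grind

theorem absSum_le (l : List ℤ) : absSum l ≤ l.length * absMax l := by
  have h := List.sum_le_card_nsmul (l.map Int.natAbs) (absMax l) (by
    simp only [List.mem_map, forall_exists_index, and_imp]
    rintro _ z hz rfl
    exact absMax_le.1 le_rfl z hz)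
  simpa [absSum] using h

theorem length_flatMap_le {α β : Type} (l : List α) (f : α → List β) (g : α → ℕ)
    (h : ∀ x, (f x).length ≤ g x) : (l.flatMap f).length ≤ (l.map g).sum := by
  rw [List.length_flatMap]
  exact List.sum_le_sum fun x _ => h x

theorem length_scalars_le (τ : Ty) (x : τ.El) : (scalars τ x).length ≤ size τ x := by
  induction τ with
  | unit => simp [scalars]
  | int => simp [scalars, size]
  | prod a b iha ihb =>
    simp only [scalars, size, List.length_append]
    exact Nat.add_le_add (iha _) (ihb _)
  | sum a b iha ihb =>
    cases x with
    | inl x => simpa [scalars, size] using Nat.le_succ_of_le (iha x)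
    | inr x => simpa [scalars, size] using Nat.le_succ_of_le (ihb x)
  | list a ih => exact Nat.le_succ_of_le (length_flatMap_le _ _ _ ih)
  | tree a ih => exact Nat.le_succ_of_le (length_flatMap_le _ _ _ ih)

theorem Env.length_scalars_le {Γ : List Ty} (t : Env Γ) : t.scalars.length ≤ t.size := by
  induction Γ with
  | nil => simp [Env.scalars]
  | cons τ Γ ih =>
    simp only [Env.scalars, Env.size, List.length_append]
    exact Nat.add_le_add (MetHyl.length_scalars_le _ _) (ih _)

/-- The size and the absolute values of a value are at most `b`. -/
def Fits (b : ℕ) (τ : Ty) (x : τ.El) : Prop := size τ x ≤ b ∧ mag τ x ≤ b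

/-- The size and the absolute values of an environment are at most `b`. -/
def Env.Fits (b : ℕ) {Γ : List Ty} (t : Env Γ) : Prop := t.size ≤ b ∧ absMax t.scalars ≤ b

theorem Fits.mono {b b' : ℕ} {τ : Ty} {x : τ.El} (h : Fits b τ x) (hb : b ≤ b') : Fits b' τ x :=
  ⟨h.1.trans hb, h.2.trans hb⟩

theorem Env.Fits.nil (b : ℕ) : Env.Fits b (Γ := []) () := by
  simp [Env.Fits, Env.size, Env.scalars, absMax]

theorem Fits.absSum_le {b : ℕ} {τ : Ty} {x : τ.El} (h : Fits b τ x) :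
    absSum (scalars τ x) ≤ b * b :=
  (MetHyl.absSum_le _).trans (Nat.mul_le_mul ((length_scalars_le _ _).trans h.1) h.2)

theorem Env.Fits.absSum_le {b : ℕ} {Γ : List Ty} {t : Env Γ} (h : t.Fits b) :
    absSum t.scalars ≤ b * b :=
  (MetHyl.absSum_le _).trans (Nat.mul_le_mul ((Env.length_scalars_le _).trans h.1) h.2)

theorem Var.fits_get {b : ℕ} {Γ : List Ty} {τ : Ty} (v : Var Γ τ) {t : Env Γ} (h : t.Fits b) :
    MetHyl.Fits b τ (v.get t) := by
  induction v with
  | head =>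
    refine ⟨le_trans ?_ h.1, (absMax_append_le.1 h.2).1⟩
    simp [Var.get, Env.size]
  | tail v ih =>
    refine ih ⟨le_trans ?_ h.1, (absMax_append_le.1 h.2).2⟩
    simp [Env.size]

/-- A type without lists and trees has only polynomially many values of bounded magnitude. -/
theorem exists_polyGrowth_card_of_isFlat {τ : Ty} (hτ : τ.isFlat = true) :
    ∃ p, PolyGrowth p ∧ ∀ W, ∃ s : Finset τ.El, (∀ x, mag τ x ≤ W → x ∈ s) ∧ s.card ≤ p W := by
  classical
  induction τ with
  | unit => exact ⟨fun _ => 1, .const 1, fun W => ⟨{()}, by simp, by simp⟩⟩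
  | int =>
    refine ⟨fun W => 2 * W + 1, ((PolyGrowth.const 2).mul .id).add (.const 1), fun W =>
      ⟨Finset.Icc (-(W : ℤ)) W, fun x hx => ?_, ?_⟩⟩
    · have h : ∀ z : ℤ, z.natAbs ≤ W → -(W : ℤ) ≤ z ∧ z ≤ W := by
        intro z hz
        omega
      exact Finset.mem_Icc.2 (h x (by simpa [mag, scalars, absMax] using hx))
    · rw [Int.card_Icc]
      show _ ≤ 2 * W + 1
      omega
  | prod a b iha ihb =>
    simp only [Ty.isFlat, Bool.and_eq_true] at hτ
    obtain ⟨p, hp, h⟩ := iha hτ.1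
    obtain ⟨q, hq, h'⟩ := ihb hτ.2
    refine ⟨_, hp.mul hq, fun W => ?_⟩
    obtain ⟨s, hs, hs'⟩ := h W
    obtain ⟨t, ht, ht'⟩ := h' W
    refine ⟨s ×ˢ t, fun x hx => ?_, ?_⟩
    · have := absMax_append_le.1 hx
      exact Finset.mem_product.2 ⟨hs _ this.1, ht _ this.2⟩
    · rw [Finset.card_product]
      exact Nat.mul_le_mul hs' ht'
  | sum a b iha ihb =>
    simp only [Ty.isFlat, Bool.and_eq_true] at hτ
    obtain ⟨p, hp, h⟩ := iha hτ.1
    obtain ⟨q, hq, h'⟩ := ihb hτ.2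
    refine ⟨_, hp.add hq, fun W => ?_⟩
    obtain ⟨s, hs, hs'⟩ := h W
    obtain ⟨t, ht, ht'⟩ := h' W
    refine ⟨s.disjSum t, fun x hx => ?_, ?_⟩
    · cases x with
      | inl x => exact Finset.inl_mem_disjSum.2 (hs x hx)
      | inr x => exact Finset.inr_mem_disjSum.2 (ht x hx)
    · rw [Finset.card_disjSum]
      exact Nat.add_le_add hs' ht'
  | list a => simp [Ty.isFlat] at hτ
  | tree a => simp [Ty.isFlat] at hτ

theorem Ty.isFlat_of_isScalar {τ : Ty} (h : τ.isScalar = true) : τ.isFlat = true := by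
  induction τ with
  | prod a b iha ihb =>
    simp only [Ty.isScalar, Bool.and_eq_true] at h
    simp [Ty.isFlat, iha h.1, ihb h.2]
  | _ => simp_all [Ty.isFlat, Ty.isScalar]

/-! ### Costs and values of expressions of polynomial cost -/

section

variable {σ : Ty} {Γ : List Ty} {τ : Ty}

/-- The number of steps of the expression is polynomial in a common bound on the input and the
temporary variables. This is implied by `Expr.PseudoPolyTime`, and is easier to combine. -/
def Expr.PolyCost (e : Expr σ Γ τ) : Prop :=
  ∃ p, PolyGrowth p ∧ ∀ (b : ℕ) (x : σ.El) (t : Env Γ), Fits b σ x → t.Fits b → e.cost x t ≤ p b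

theorem Expr.PseudoPolyTime.polyCost {e : Expr σ Γ τ} (h : e.PseudoPolyTime) : e.PolyCost := by
  obtain ⟨c, k, h⟩ := h
  have hp : PolyGrowth fun b => c * (b + b + b + 1) ^ k :=
    (PolyGrowth.const c).mul ((((PolyGrowth.id.add .id).add .id).add (.const 1)).pow k)
  refine ⟨_, hp, fun b x t hx ht => (h (x, t)).trans ?_⟩
  have h1 := hx.1
  have h2 := ht.1
  have h3 : absMax (MetHyl.scalars σ x ++ t.scalars) ≤ b := absMax_append_le.2 ⟨hx.2, ht.2⟩
  dsimp only
  gcongr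

theorem Expr.cost_op {m n : ℕ} {a : Fin m → Ty} {L : Fin n → List Ty × Ty} (f : Op a L τ)
    (args : ∀ j, Expr σ Γ (a j)) (lams : ∀ j, Expr σ ((L j).1 ++ Γ) (L j).2) (x : σ.El)
    (t : Env Γ) :
    (Expr.op f args lams).cost x t =
      (∑ j, (args j).cost x t) + f.cost (fun j => (args j).val x t) +
      ((f.sem fun j => (args j).val x t).run fun j xs => (lams j).eval x (xs.append t)).2 +
      size τ ((Expr.op f args lams).val x t) + 1 := rfl

theorem Expr.val_op {m n : ℕ} {a : Fin m → Ty} {L : Fin n → List Ty × Ty} (f : Op a L τ)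
    (args : ∀ j, Expr σ Γ (a j)) (lams : ∀ j, Expr σ ((L j).1 ++ Γ) (L j).2) (x : σ.El)
    (t : Env Γ) :
    (Expr.op f args lams).val x t =
      ((f.sem fun j => (args j).val x t).run fun j xs => (lams j).eval x (xs.append t)).1 := rfl

theorem Expr.one_le_cost (e : Expr σ Γ τ) (x : σ.El) (t : Env Γ) : 1 ≤ e.cost x t := by
  cases e with
  | op f args lams => rw [Expr.cost_op]; omega
  | _ => exact le_rfl

/-- An operator application pays for its output; the other expressions copy. -/
theorem Expr.size_val_le (e : Expr σ Γ τ) : ∃ c : ℕ, ∀ (b : ℕ) (x : σ.El) (t : Env Γ),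
    Fits b σ x → t.Fits b → size τ (e.val x t) ≤ e.cost x t + b + c := by
  cases e with
  | inp => exact ⟨0, fun b x t hx _ => hx.1.trans (by omega)⟩
  | tmp v => exact ⟨0, fun b x t _ ht => (v.fits_get ht).1.trans (by omega)⟩
  | const v => exact ⟨size τ v, fun b x t _ _ => by simp [Expr.val, Expr.eval]⟩
  | op f args lams => exact ⟨0, fun b x t _ _ => by rw [Expr.cost_op]; omega⟩

theorem Expr.PolyCost.size_val_le {e : Expr σ Γ τ} (h : e.PolyCost) :
    ∃ p, PolyGrowth p ∧ ∀ (b : ℕ) (x : σ.El) (t : Env Γ),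
      Fits b σ x → t.Fits b → size τ (e.val x t) ≤ p b := by
  obtain ⟨p, hp, h⟩ := h
  obtain ⟨c, hc⟩ := e.size_val_le
  refine ⟨_, (hp.add .id).add (.const c), fun b x t hx ht => (hc b x t hx ht).trans ?_⟩
  have := h b x t hx ht
  omega

/-- An expression of polynomial cost has polynomially bounded values if its operators are linear:
the sizes are paid for, and each of the nested operators increases the absolute values at most
linearly. -/
theorem Expr.PolyCost.exists_fits_val {e : Expr σ Γ τ} (h : e.PolyCost) (hl : e.LinearOps) :
    ∃ p, PolyGrowth p ∧ ∀ (b : ℕ) (x : σ.El) (t : Env Γ),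
      Fits b σ x → t.Fits b → Fits (p b) τ (e.val x t) := by
  induction e with
  | inp => exact ⟨_, .id, fun b x t hx _ => hx⟩
  | tmp v => exact ⟨_, .id, fun b x t _ ht => v.fits_get ht⟩
  | @const Γ τ v =>
    exact ⟨fun _ => size τ v + mag τ v, .const _, fun b x t _ _ =>
      ⟨Nat.le_add_right _ _, Nat.le_add_left _ _⟩⟩
  | @op Γ τ m n a L f args lams iha _ =>
    obtain ⟨⟨c, hc⟩, hargs, _⟩ := hl
    obtain ⟨s, hs, hs'⟩ := h.size_val_le
    have hargs' : ∀ j, (args j).PolyCost := by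
      intro j
      obtain ⟨p, hp, h⟩ := h
      refine ⟨p, hp, fun b x t hx ht => le_trans ?_ (h b x t hx ht)⟩
      have : (args j).cost x t ≤ ∑ j, (args j).cost x t :=
        Finset.single_le_sum (f := fun j => (args j).cost x t) (fun _ _ => Nat.zero_le _)
          (Finset.mem_univ j)
      rw [Expr.cost_op]
      omega
    choose q hq hq' using fun j => iha j (hargs' j) (hargs j)
    have hB : PolyGrowth fun b => (∑ j, (q j b * q j b + q j b)) :=
      PolyGrowth.sum _ fun j _ => ((hq j).mul (hq j)).add (hq j)
    have hD : PolyGrowth fun b => b * b + b := (PolyGrowth.id.mul .id).add .id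
    refine ⟨_, hs.add ((PolyGrowth.const c).mul ((((PolyGrowth.const 1).add hB).add hD).add hD)),
      fun b x t hx ht => ⟨(hs' b x t hx ht).trans (Nat.le_add_right _ _), ?_⟩⟩
    refine (hc x t).trans (le_trans ?_ (Nat.le_add_left _ _))
    refine Nat.mul_le_mul_left _ ?_
    refine Nat.add_le_add (Nat.add_le_add (Nat.add_le_add le_rfl ?_) ?_) ?_
    · exact Finset.sum_le_sum fun j _ =>
        Nat.add_le_add (hq' j b x t hx ht).absSum_le (hq' j b x t hx ht).1
    · exact Nat.add_le_add hx.absSum_le hx.1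
    · exact Nat.add_le_add ht.absSum_le ht.1

end

/-! ### Rewriting of expressions -/

section

variable {n : ℕ} {L : Fin n → List Ty × Ty} {ρ : Ty}

theorem Comp.run_fst_congr {h h' : ∀ j, Env (L j).1 → (L j).2.El × ℕ} (c : Comp L ρ)
    (H : ∀ q ∈ c.calls h, (h' q.1 q.2).1 = (h q.1 q.2).1) : (c.run h').1 = (c.run h).1 := by
  induction c with
  | ret v => rfl
  | call j xs k ih =>
    simp only [Comp.calls, Set.mem_union, Set.mem_singleton_iff] at H
    have h1 := H ⟨j, xs⟩ (Or.inl rfl)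
    simp only [Comp.run]
    rw [h1]
    exact ih _ fun q hq => H q (Or.inr hq)

theorem Comp.run_snd_le {h h' : ∀ j, Env (L j).1 → (L j).2.El × ℕ} {Q : ℕ} (hQ : 1 ≤ Q)
    (c : Comp L ρ)
    (H : ∀ q ∈ c.calls h, (h' q.1 q.2).1 = (h q.1 q.2).1 ∧ (h' q.1 q.2).2 ≤ Q * (h q.1 q.2).2) :
    (c.run h').2 ≤ Q * (c.run h).2 := by
  induction c with
  | ret v => simp [Comp.run]
  | call j xs k ih =>
    simp only [Comp.calls, Set.mem_union, Set.mem_singleton_iff] at H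
    have h1 := H ⟨j, xs⟩ (Or.inl rfl)
    dsimp only at h1
    have h2 := ih (h j xs).1 fun q hq => H q (Or.inr hq)
    have h3 := h1.2
    simp only [Comp.run]
    rw [h1.1]
    rw [Nat.mul_add, Nat.mul_add]
    omega

end

section

variable {σ : Ty}

theorem Expr.mem_trace_self {cut : ∀ ⦃Γ : List Ty⦄ ⦃τ : Ty⦄, Expr σ Γ τ → Prop} {Γ : List Ty}
    {τ : Ty} (e : Expr σ Γ τ) (x : σ.El) (t : Env Γ) : (⟨e, t⟩ : Point σ) ∈ e.trace cut x t := by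
  cases e <;> simp [Expr.trace]

theorem Expr.trace_subset {cut : ∀ ⦃Γ : List Ty⦄ ⦃τ : Ty⦄, Expr σ Γ τ → Prop} {x : σ.El}
    {Γ : List Ty} {τ : Ty} (e : Expr σ Γ τ) (t : Env Γ) :
    e.trace cut x t ⊆ e.trace (fun _ _ _ => False) x t := by
  induction e with
  | op f args lams iha ihl =>
    intro p hp
    simp only [Expr.trace, Set.mem_union, Set.mem_ofPred_eq, not_false_eq_true, true_and] at hp ⊢
    rcases hp with hp | ⟨_, ⟨j, hj⟩ | ⟨c, hc, hj⟩⟩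
    · exact Or.inl hp
    · exact Or.inr (Or.inl ⟨j, iha j t hj⟩)
    · exact Or.inr (Or.inr ⟨c, hc, ihl _ _ hj⟩)
  | _ => exact subset_rfl

variable {σ' : Ty} {q : ∀ ⦃Γ : List Ty⦄ ⦃τ : Ty⦄, Expr σ Γ τ → Expr σ' Γ τ}

theorem Expr.val_rewrite {Q : ∀ ⦃Γ : List Ty⦄ ⦃τ : Ty⦄, Expr σ' Γ τ → Prop} {Γ : List Ty} {τ : Ty}
    {e : Expr σ Γ τ} (he : e.RewriteOK q Q) {x : σ.El} {x' : σ'.El} {t : Env Γ}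
    (H : ∀ p ∈ e.trace (fun _ _ e => e.isQuery = true) x t, p.e.isQuery = true →
      p.e.val x p.t = (q p.e).val x' p.t) :
    (e.rewrite q).val x' t = e.val x t := by
  induction e with
  | inp => exact he.elim
  | tmp v => rfl
  | const v => rfl
  | op f args lams iha ihl =>
    by_cases hq : (Expr.op f args lams).isQuery = true
    · rw [Expr.rewrite, if_pos hq]
      exact (H _ (Expr.mem_trace_self _ _ _) hq).symm
    · simp only [Expr.RewriteOK, if_neg hq] at he
      simp only [Expr.trace, Set.mem_union, Set.mem_ofPred_eq] at H
      rw [Expr.rewrite, if_neg hq, Expr.val_op, Expr.val_op]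
      have hv : (fun j => ((args j).rewrite q).val x' t) = fun j => (args j).val x t :=
        funext fun j => iha j (he.1 j) fun p hp => H p (Or.inr ⟨hq, Or.inl ⟨j, hp⟩⟩)
      rw [hv]
      refine Comp.run_fst_congr _ fun c hc => ?_
      exact ihl c.1 (he.2 c.1) fun p hp => H p (Or.inr ⟨hq, Or.inr ⟨c, hc, hp⟩⟩)

/-- Replacing queries by programs of polynomial cost multiplies the cost of an expression by at
most a polynomial factor: all operators that are kept do the same calls on the same values. -/
theorem Expr.exists_cost_rewrite_le {Γ : List Ty} {τ : Ty} {e : Expr σ Γ τ}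
    (he : e.RewriteOK q fun _ _ e => e.PolyCost) :
    ∃ Q, PolyGrowth Q ∧ ∀ (b : ℕ) (x : σ.El) (x' : σ'.El) (t : Env Γ), Fits b σ' x' →
      (∀ p ∈ e.trace (fun _ _ e => e.isQuery = true) x t, p.e.isQuery = true →
        p.e.val x p.t = (q p.e).val x' p.t ∧ p.t.Fits b) →
      (e.rewrite q).cost x' t ≤ Q b * e.cost x t := by
  induction e with
  | inp => exact he.elim
  | tmp v => exact ⟨_, .const 1, fun b x x' t _ _ => by simp [Expr.rewrite, Expr.cost, Expr.eval]⟩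
  | const v => exact ⟨_, .const 1, fun b x x' t _ _ => by simp [Expr.rewrite, Expr.cost, Expr.eval]⟩
  | op f args lams iha ihl =>
    by_cases hq : (Expr.op f args lams).isQuery = true
    · simp only [Expr.RewriteOK, if_pos hq] at he
      obtain ⟨p, hp, h⟩ := he
      refine ⟨p, hp, fun b x x' t hx' H => ?_⟩
      rw [Expr.rewrite, if_pos hq]
      exact (h b x' t hx' (H _ (Expr.mem_trace_self _ _ _) hq).2).trans
        (Nat.le_mul_of_pos_right _ (Expr.one_le_cost _ _ _))
    · simp only [Expr.RewriteOK, if_neg hq] at he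
      choose qa hqa ha using fun j => iha j (he.1 j)
      choose ql hql hl using fun j => ihl j (he.2 j)
      refine ⟨_, ((PolyGrowth.const 1).add (PolyGrowth.sum Finset.univ fun j _ => hqa j)).add
        (PolyGrowth.sum Finset.univ fun j _ => hql j), fun b x x' t hx' H => ?_⟩
      simp only [Expr.trace, Set.mem_union, Set.mem_ofPred_eq] at H
      have hv : (fun j => ((args j).rewrite q).val x' t) = fun j => (args j).val x t :=
        funext fun j => Expr.val_rewrite (he.1 j) fun p hp hpq =>
          (H p (Or.inr ⟨hq, Or.inl ⟨j, hp⟩⟩) hpq).1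
      have hval : ((Expr.op f args lams).rewrite q).val x' t = (Expr.op f args lams).val x t := by
        refine Expr.val_rewrite (Q := fun _ _ e => e.PolyCost) ?_ fun p hp hpq => ?_
        · simp only [Expr.RewriteOK, if_neg hq]
          exact he
        · simp only [Expr.trace, Set.mem_union, Set.mem_ofPred_eq] at hp
          exact (H p hp hpq).1
      rw [Expr.rewrite, if_neg hq] at hval ⊢
      rw [Expr.cost_op, Expr.cost_op, hval, hv]
      set Q := 1 + (∑ j, qa j b) + ∑ j, ql j b with hQ
      have hQ1 : 1 ≤ Q := by omega
      have hQa : ∀ j, qa j b ≤ Q := fun j => by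
        have := Finset.single_le_sum (f := fun j => qa j b) (fun _ _ => Nat.zero_le _)
          (Finset.mem_univ j)
        omega
      have hQl : ∀ j, ql j b ≤ Q := fun j => by
        have := Finset.single_le_sum (f := fun j => ql j b) (fun _ _ => Nat.zero_le _)
          (Finset.mem_univ j)
        omega
      simp only [Nat.mul_add]
      refine Nat.add_le_add (Nat.add_le_add (Nat.add_le_add (Nat.add_le_add ?_ ?_) ?_) ?_) ?_
      · rw [Finset.mul_sum]
        refine Finset.sum_le_sum fun j _ => (ha j b x x' t hx' fun p hp => ?_).trans
          (Nat.mul_le_mul_right _ (hQa j))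
        exact H p (Or.inr ⟨hq, Or.inl ⟨j, hp⟩⟩)
      · exact Nat.le_mul_of_pos_left _ hQ1
      · refine Comp.run_snd_le hQ1 _ fun c hc => ?_
        have H' : ∀ p ∈ (lams c.1).trace (fun _ _ e => e.isQuery = true) x (c.2.append t),
            p.e.isQuery = true → p.e.val x p.t = (q p.e).val x' p.t ∧ p.t.Fits b :=
          fun p hp => H p (Or.inr ⟨hq, Or.inr ⟨c, hc, hp⟩⟩)
        exact ⟨Expr.val_rewrite (he.2 c.1) fun p hp hpq => (H' p hp hpq).1,
          (hl c.1 b x x' _ hx' H').trans (Nat.mul_le_mul_right _ (hQl c.1))⟩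
      · exact Nat.le_mul_of_pos_left _ hQ1
      · omega

end

/-! ### Assembled transitions -/

section

variable {σ : Ty} {Γ : List Ty}

theorem Expr.PolyCost.op {τ : Ty} {m n : ℕ} {a : Fin m → Ty} {L : Fin n → List Ty × Ty}
    {f : Op a L τ}
    {args : ∀ j, Expr σ Γ (a j)} {lams : ∀ j, Expr σ ((L j).1 ++ Γ) (L j).2}
    (hf : ∀ v, f.cost v = 0) (hargs : ∀ j, (args j).PolyCost) {r s : ℕ → ℕ} (hr : PolyGrowth r)
    (hs : PolyGrowth s)
    (h : ∀ (b : ℕ) (x : σ.El) (t : Env Γ), Fits b σ x → t.Fits b →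
      ((f.sem fun j => (args j).val x t).run fun j xs => (lams j).eval x (xs.append t)).2 ≤ r b ∧
      size τ ((Expr.op f args lams).val x t) ≤ s b) :
    (Expr.op f args lams).PolyCost := by
  choose p hp hp' using hargs
  refine ⟨_, (((PolyGrowth.sum Finset.univ fun j _ => hp j).add hr).add hs).add (.const 1),
    fun b x t hx ht => ?_⟩
  rw [Expr.cost_op, hf]
  have h1 : ∑ j, (args j).cost x t ≤ ∑ j, p j b :=
    Finset.sum_le_sum fun j _ => hp' j b x t hx ht
  have h2 := h b x t hx ht
  omega

theorem Expr.PolyCost.pair {a b : Ty} {e₁ : Expr σ Γ a} {e₂ : Expr σ Γ b} (h₁ : e₁.PolyCost)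
    (h₂ : e₂.PolyCost) : (Expr.pair e₁ e₂).PolyCost := by
  obtain ⟨s₁, hs₁, h₁'⟩ := h₁.size_val_le
  obtain ⟨s₂, hs₂, h₂'⟩ := h₂.size_val_le
  refine Expr.PolyCost.op (fun _ => rfl) (fun j => ?_) (.const 0) (hs₁.add hs₂)
    fun c x t hx ht => ⟨le_rfl, Nat.add_le_add (h₁' c x t hx ht) (h₂' c x t hx ht)⟩
  match j with
  | 0 => exact h₁
  | 1 => exact h₂

theorem Expr.PolyCost.inl {a b : Ty} {e : Expr σ Γ a} (h : e.PolyCost) :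
    (Expr.inl (b := b) e).PolyCost := by
  obtain ⟨s, hs, h'⟩ := h.size_val_le
  refine Expr.PolyCost.op (fun _ => rfl) (fun j => ?_) (.const 0) (hs.add (.const 1))
    fun c x t hx ht => ⟨le_rfl, Nat.add_le_add (h' c x t hx ht) le_rfl⟩
  match j with
  | 0 => exact h

theorem Expr.PolyCost.inr {a b : Ty} {e : Expr σ Γ b} (h : e.PolyCost) :
    (Expr.inr (a := a) e).PolyCost := by
  obtain ⟨s, hs, h'⟩ := h.size_val_le
  refine Expr.PolyCost.op (fun _ => rfl) (fun j => ?_) (.const 0) (hs.add (.const 1))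
    fun c x t hx ht => ⟨le_rfl, Nat.add_le_add (h' c x t hx ht) le_rfl⟩
  match j with
  | 0 => exact h

theorem Expr.PolyCost.cond {a : Ty} {e : Expr σ Γ .int} {e₁ e₂ : Expr σ Γ a} (h : e.PolyCost)
    (h₁ : e₁.PolyCost) (h₂ : e₂.PolyCost) : (Expr.cond e e₁ e₂).PolyCost := by
  obtain ⟨s₁, hs₁, h₁'⟩ := h₁.size_val_le
  obtain ⟨s₂, hs₂, h₂'⟩ := h₂.size_val_le
  obtain ⟨p₁, hp₁, h₁''⟩ := h₁
  obtain ⟨p₂, hp₂, h₂''⟩ := h₂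
  refine Expr.PolyCost.op (fun _ => rfl) (fun j => ?_) ((hp₁.add hp₂).add (.const 1))
    (hs₁.add hs₂) fun c x t hx ht => ?_
  · match j with
    | 0 => exact h
  · have e1 := h₁' c x t hx ht
    have e2 := h₂' c x t hx ht
    have e3 := h₁'' c x t hx ht
    have e4 := h₂'' c x t hx ht
    rw [Expr.val_op]
    by_cases hb : e.val x t ≠ 0
    · have : (condOp a).sem (fun j => (Fin.cons (α := fun j => Expr σ Γ (![Ty.int] j)) e
          (fun j => j.elim0) j : Expr σ Γ (![Ty.int] j)).val x t) =
          .call 0 () fun y => .ret y := by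
        simp only [condOp]
        exact congrArg (fun j =>
          (Comp.call j () fun y => .ret y : Comp (fun _ : Fin 2 => (([] : List Ty), a)) a))
          (if_pos hb)
      rw [this]
      exact ⟨Nat.add_le_add (e3.trans (Nat.le_add_right _ _)) le_rfl,
        e1.trans (Nat.le_add_right _ _)⟩
    · have : (condOp a).sem (fun j => (Fin.cons (α := fun j => Expr σ Γ (![Ty.int] j)) e
          (fun j => j.elim0) j : Expr σ Γ (![Ty.int] j)).val x t) =
          .call 1 () fun y => .ret y := by
        simp only [condOp]
        exact congrArg (fun j =>
          (Comp.call j () fun y => .ret y : Comp (fun _ : Fin 2 => (([] : List Ty), a)) a))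
          (if_neg hb)
      rw [this]
      exact ⟨Nat.add_le_add (e4.trans (Nat.le_add_left _ _)) le_rfl,
        e2.trans (Nat.le_add_left _ _)⟩

theorem Assembled.polyCost {G : Grammar} {B : Ty}
    (hG : ∀ ⦃σ : Ty⦄ ⦃Γ : List Ty⦄ ⦃τ : Ty⦄ (e : Expr σ Γ τ), G e → e.PolyCost) {F : Func}
    {e : Expr σ Γ (F.app B)} (h : Assembled G F e) : e.PolyCost := by
  induction h with
  | id e he => exact hG e he
  | unit => exact ⟨_, .const 1, fun _ _ _ _ _ => le_rfl⟩
  | int e he => exact hG e he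
  | prod F₁ F₂ e₁ e₂ _ _ ih₁ ih₂ => exact ih₁.pair ih₂
  | inl F₁ F₂ e _ ih => exact ih.inl
  | inr F₁ F₂ e _ ih => exact ih.inr
  | cond F₁ F₂ e e₁ e₂ he _ _ ih₁ ih₂ => exact (hG e he).cond ih₁.inl ih₂.inr

end

/-! ### Rewriting of statements -/

section

variable {σ ρ : Ty}

theorem Stmt.length_eval_le {Γ : List Ty} (s : Stmt σ ρ Γ) (x : σ.El) (t : Env Γ) :
    (s.eval x t).1.length ≤ (s.eval x t).2 := by
  induction s with
  | skip => simp [Stmt.eval]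
  | seq s₁ s₂ ih₁ ih₂ =>
    have h₁ := ih₁ t
    have h₂ := ih₂ t
    simp only [Stmt.eval, List.length_append]
    omega
  | ite e s₁ s₂ ih₁ ih₂ =>
    have h₁ := ih₁ t
    have h₂ := ih₂ t
    simp only [Stmt.eval]
    split_ifs <;> omega
  | collect e => simp [Stmt.eval]
  | foreach e body ih =>
    simp only [Stmt.eval, List.length_flatMap, List.map_map]
    refine le_trans (List.sum_le_sum
      (g := (fun r => r.2 + 1) ∘ fun y => body.eval x (y, t)) fun y _ => ?_) (by omega)
    exact (ih (y, t)).trans (Nat.le_succ _)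

/-- Every collected value is the value of a collected expression. -/
theorem Stmt.exists_collects {Γ : List Ty} (s : Stmt σ ρ Γ) {x : σ.El} {t : Env Γ} {v : ρ.El}
    (h : v ∈ (s.eval x t).1) : ∃ p ∈ s.collects x t, p.2.1.val x p.2.2 = v := by
  induction s with
  | skip => simp [Stmt.eval] at h
  | seq s₁ s₂ ih₁ ih₂ =>
    simp only [Stmt.eval, List.mem_append] at h
    rcases h with h | h
    · obtain ⟨p, hp, hv⟩ := ih₁ h
      exact ⟨p, Or.inl hp, hv⟩
    · obtain ⟨p, hp, hv⟩ := ih₂ h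
      exact ⟨p, Or.inr hp, hv⟩
  | ite e s₁ s₂ ih₁ ih₂ =>
    simp only [Stmt.eval] at h
    simp only [Stmt.collects, Set.mem_ofPred_eq]
    split_ifs at h ⊢
    · exact ih₁ h
    · exact ih₂ h
  | collect e =>
    simp only [Stmt.eval, List.mem_singleton] at h
    exact ⟨_, Set.mem_singleton _, h.symm⟩
  | foreach e body ih =>
    simp only [Stmt.eval, List.mem_flatMap, List.mem_map] at h
    obtain ⟨_, ⟨y, hy, rfl⟩, h⟩ := h
    obtain ⟨p, hp, hv⟩ := ih h
    exact ⟨p, ⟨y, hy, hp⟩, hv⟩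

theorem Stmt.exists_evaluated {s : Stmt σ ρ []} {x : σ.El} {v : ρ.El} (h : v ∈ s.out x) :
    ∃ (Γ : List Ty) (e : Expr σ Γ ρ) (t : Env Γ), (⟨e, t⟩ : Point σ) ∈ s.evaluated x ∧
      e.val x t = v := by
  obtain ⟨⟨Γ, e, t⟩, hp, hv⟩ := s.exists_collects h
  exact ⟨Γ, e, t, Or.inr ⟨_, hp, Expr.mem_trace_self _ _ _⟩, hv⟩

variable {σ' ρ' : Ty} {q : ∀ ⦃Γ : List Ty⦄ ⦃τ : Ty⦄, Expr σ Γ τ → Expr σ' Γ τ}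
  {c : ∀ ⦃Γ : List Ty⦄, Expr σ Γ ρ → Expr σ' Γ ρ'}

theorem Expr.RewriteOK.mono {Q Q' : ∀ ⦃Γ : List Ty⦄ ⦃τ : Ty⦄, Expr σ' Γ τ → Prop}
    (hQ : ∀ ⦃Γ : List Ty⦄ ⦃τ : Ty⦄ (e : Expr σ' Γ τ), Q e → Q' e) {Γ : List Ty} {τ : Ty}
    {e : Expr σ Γ τ} (h : e.RewriteOK q Q) : e.RewriteOK q Q' := by
  induction e with
  | inp => exact h
  | tmp v => trivial
  | const v => trivial
  | op f args lams iha ihl =>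
    simp only [Expr.RewriteOK] at h ⊢
    split_ifs at h ⊢
    · exact hQ _ h
    · exact ⟨fun j => iha j (h.1 j), fun j => ihl j (h.2 j)⟩

theorem Stmt.RewriteOK.mono {Q Q' : ∀ ⦃Γ : List Ty⦄ ⦃τ : Ty⦄, Expr σ' Γ τ → Prop}
    (hQ : ∀ ⦃Γ : List Ty⦄ ⦃τ : Ty⦄ (e : Expr σ' Γ τ), Q e → Q' e)
    {C C' : ∀ ⦃Γ : List Ty⦄, Expr σ' Γ ρ' → Prop}
    (hC : ∀ ⦃Γ : List Ty⦄ (e : Expr σ' Γ ρ'), C e → C' e) {Γ : List Ty} {s : Stmt σ ρ Γ}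
    (h : s.RewriteOK q c Q C) : s.RewriteOK q c Q' C' := by
  induction s with
  | skip => trivial
  | seq s₁ s₂ ih₁ ih₂ => exact ⟨ih₁ h.1, ih₂ h.2⟩
  | ite e s₁ s₂ ih₁ ih₂ => exact ⟨h.1.mono hQ, ih₁ h.2.1, ih₂ h.2.2⟩
  | collect e => exact hC _ h
  | foreach e body ih => exact ⟨h.1.mono hQ, ih h.2⟩

theorem Stmt.eval_rewrite_fst {Q : ∀ ⦃Γ : List Ty⦄ ⦃τ : Ty⦄, Expr σ' Γ τ → Prop}
    {C : ∀ ⦃Γ : List Ty⦄, Expr σ' Γ ρ' → Prop} {g : ρ.El → ρ'.El} {Γ : List Ty}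
    {s : Stmt σ ρ Γ} (hs : s.RewriteOK q c Q C) {x : σ.El} {x' : σ'.El} {t : Env Γ}
    (H : ∀ r ∈ s.tests x t, ∀ p ∈ r.e.trace (fun _ _ e => e.isQuery = true) x r.t,
      p.e.isQuery = true → p.e.val x p.t = (q p.e).val x' p.t)
    (H' : ∀ p ∈ s.collects x t, g (p.2.1.val x p.2.2) = (c p.2.1).val x' p.2.2) :
    ((s.rewrite q c).eval x' t).1 = (s.eval x t).1.map g := by
  induction s with
  | skip => rfl
  | seq s₁ s₂ ih₁ ih₂ =>
    simp only [Stmt.rewrite, Stmt.eval, List.map_append]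
    rw [ih₁ hs.1 (fun r hr => H r (Or.inl hr)) fun p hp => H' p (Or.inl hp),
      ih₂ hs.2 (fun r hr => H r (Or.inr hr)) fun p hp => H' p (Or.inr hp)]
  | ite e s₁ s₂ ih₁ ih₂ =>
    have he := Expr.val_rewrite hs.1 (H ⟨e, t⟩ (Or.inl rfl))
    simp only [Stmt.rewrite, Stmt.eval, he]
    simp only [Stmt.tests, Stmt.collects, Set.mem_union, Set.mem_ofPred_eq] at H H'
    split_ifs with hc
    · simp only [if_pos hc] at H H'
      exact ih₁ hs.2.1 (fun r hr => H r (Or.inr hr)) H'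
    · simp only [if_neg hc] at H H'
      exact ih₂ hs.2.2 (fun r hr => H r (Or.inr hr)) H'
  | @collect Γ e =>
    simp only [Stmt.rewrite, Stmt.eval, List.map_cons, List.map_nil]
    rw [← H' ⟨Γ, e, t⟩ (Set.mem_singleton _)]
  | foreach e body ih =>
    have he := Expr.val_rewrite hs.1 (H ⟨e, t⟩ (Or.inl rfl))
    simp only [Stmt.rewrite, Stmt.eval, he, List.flatMap_map, List.map_flatMap]
    refine List.flatMap_congr fun y hy => ?_
    exact ih hs.2 (fun r hr => H r (Or.inr ⟨y, hy, hr⟩)) fun p hp => H' p ⟨y, hy, hp⟩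

theorem Stmt.exists_cost_rewrite_le {g : ρ.El → ρ'.El} {Γ : List Ty} {s : Stmt σ ρ Γ}
    (hs : s.RewriteOK q c (fun _ _ e => e.PolyCost) fun _ e => e.PolyCost) :
    ∃ Q, PolyGrowth Q ∧ ∀ (b : ℕ) (x : σ.El) (x' : σ'.El) (t : Env Γ), Fits b σ' x' →
      (∀ r ∈ s.tests x t, ∀ p ∈ r.e.trace (fun _ _ e => e.isQuery = true) x r.t,
        p.e.isQuery = true → p.e.val x p.t = (q p.e).val x' p.t ∧ p.t.Fits b) →
      (∀ p ∈ s.collects x t, g (p.2.1.val x p.2.2) = (c p.2.1).val x' p.2.2 ∧ p.2.2.Fits b) →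
      ((s.rewrite q c).eval x' t).2 ≤ Q b * (s.eval x t).2 := by
  induction s with
  | skip => exact ⟨_, .const 1, fun b x x' t _ _ _ => by simp [Stmt.rewrite, Stmt.eval]⟩
  | seq s₁ s₂ ih₁ ih₂ =>
    obtain ⟨Q₁, hQ₁, h₁⟩ := ih₁ hs.1
    obtain ⟨Q₂, hQ₂, h₂⟩ := ih₂ hs.2
    refine ⟨_, (hQ₁.add hQ₂).add (.const 1), fun b x x' t hx' H H' => ?_⟩
    have e₁ := h₁ b x x' t hx' (fun r hr => H r (Or.inl hr)) fun p hp => H' p (Or.inl hp)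
    have e₂ := h₂ b x x' t hx' (fun r hr => H r (Or.inr hr)) fun p hp => H' p (Or.inr hp)
    simp only [Stmt.rewrite, Stmt.eval]
    nlinarith
  | ite e s₁ s₂ ih₁ ih₂ =>
    obtain ⟨Q₀, hQ₀, h₀⟩ := Expr.exists_cost_rewrite_le hs.1
    obtain ⟨Q₁, hQ₁, h₁⟩ := ih₁ hs.2.1
    obtain ⟨Q₂, hQ₂, h₂⟩ := ih₂ hs.2.2
    refine ⟨_, ((hQ₀.add hQ₁).add hQ₂).add (.const 1), fun b x x' t hx' H H' => ?_⟩
    have e₀ := h₀ b x x' t hx' (H ⟨e, t⟩ (Or.inl rfl))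
    have he := Expr.val_rewrite hs.1 fun p hp hq => (H ⟨e, t⟩ (Or.inl rfl) p hp hq).1
    simp only [Stmt.rewrite, Stmt.eval, he]
    simp only [Stmt.tests, Stmt.collects, Set.mem_union, Set.mem_ofPred_eq] at H H'
    split_ifs with hc
    · simp only [if_pos hc] at H H'
      have e₁ := h₁ b x x' t hx' (fun r hr => H r (Or.inr hr)) H'
      nlinarith
    · simp only [if_neg hc] at H H'
      have e₂ := h₂ b x x' t hx' (fun r hr => H r (Or.inr hr)) H'
      nlinarith
  | @collect Γ e =>
    obtain ⟨p, hp, h⟩ := hs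
    refine ⟨_, hp.add (.const 1), fun b x x' t hx' H H' => ?_⟩
    have e₁ := h b x' t hx' (H' ⟨Γ, e, t⟩ (Set.mem_singleton _)).2
    simp only [Stmt.rewrite, Stmt.eval]
    nlinarith
  | foreach e body ih =>
    obtain ⟨Q₀, hQ₀, h₀⟩ := Expr.exists_cost_rewrite_le hs.1
    obtain ⟨Q₁, hQ₁, h₁⟩ := ih hs.2
    refine ⟨_, (hQ₀.add hQ₁).add (.const 1), fun b x x' t hx' H H' => ?_⟩
    have e₀ := h₀ b x x' t hx' (H ⟨e, t⟩ (Or.inl rfl))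
    have he := Expr.val_rewrite hs.1 fun p hp hq => (H ⟨e, t⟩ (Or.inl rfl) p hp hq).1
    simp only [Stmt.rewrite, Stmt.eval, he, List.map_map]
    have e₁ : ((e.val x t).map
          ((fun r => r.2 + 1) ∘ fun y => (body.rewrite q c).eval x' (y, t))).sum ≤
        (Q₁ b + 1) * ((e.val x t).map ((fun r => r.2 + 1) ∘ fun y => body.eval x (y, t))).sum := by
      rw [← List.sum_map_mul_left]
      refine List.sum_le_sum fun y hy => ?_
      have := h₁ b x x' (y, t) hx' (fun r hr => H r (Or.inr ⟨y, hy, hr⟩))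
        fun p hp => H' p ⟨y, hy, hp⟩
      simp only [Function.comp]
      nlinarith
    generalize ((e.val x t).map ((fun r => r.2 + 1) ∘ fun y => body.eval x (y, t))).sum = S at e₁ ⊢
    nlinarith [Nat.zero_le (Q₀ b * S), Nat.zero_le (Q₁ b * e.cost x t)]

end

section

variable {σ ρ σ' ρ' : Ty} {q : ∀ ⦃Γ : List Ty⦄ ⦃τ : Ty⦄, Expr σ Γ τ → Expr σ' Γ τ}
  {c : ∀ ⦃Γ : List Ty⦄, Expr σ Γ ρ → Expr σ' Γ ρ'} {s : Stmt σ ρ []}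

theorem Stmt.RewriteSpec.out_eq {Q : ∀ ⦃Γ : List Ty⦄ ⦃τ : Ty⦄, Expr σ' Γ τ → Prop}
    {C : ∀ ⦃Γ : List Ty⦄, Expr σ' Γ ρ' → Prop} (hs : s.RewriteOK q c Q C)
    {f : σ.El → σ'.El} {g : ρ.El → ρ'.El} {x : σ.El} (h : s.RewriteSpec q c f g x) :
    (s.rewrite q c).out (f x) = (s.out x).map g :=
  Stmt.eval_rewrite_fst hs (fun r hr p hp hq => h.1 p ⟨⟨r, hr, hp⟩, hq⟩) h.2

/-- A correctly rewritten program runs at most polynomially longer than the original one, relative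
to a bound on its input and on the temporary variables of the original program. -/
theorem Stmt.RewriteOK.exists_cost_le
    (hs : s.RewriteOK q c (fun _ _ e => e.PolyCost) fun _ e => e.PolyCost)
    (f : σ.El → σ'.El) (g : ρ.El → ρ'.El) :
    ∃ Q, PolyGrowth Q ∧ ∀ (b : ℕ) (x : σ.El), Fits b σ' (f x) → s.RewriteSpec q c f g x →
      (∀ p ∈ s.evaluated x, p.t.Fits b) → (s.rewrite q c).cost (f x) ≤ Q b * s.cost x := by
  obtain ⟨Q, hQ, h⟩ := Stmt.exists_cost_rewrite_le (g := g) hs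
  refine ⟨Q, hQ, fun b x hx hspec hev => h b x (f x) () hx (fun r hr p hp hq => ?_) fun p hp => ?_⟩
  · exact ⟨hspec.1 p ⟨⟨r, hr, hp⟩, hq⟩, hev p (Or.inl ⟨r, hr, Expr.trace_subset _ _ hp⟩)⟩
  · exact ⟨hspec.2 p hp, hev ⟨p.2.1, p.2.2⟩ (Or.inr ⟨p, hp, Expr.mem_trace_self _ _ _⟩)⟩

end

/-! ### Structures of a polynomial functor -/

namespace Func

/-- The number of occurrences of the identity functor in a polynomial functor, a bound on the number
of components of its structures. -/
def arity : Func → ℕ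
  | .id => 1
  | .unit => 0
  | .int => 0
  | .prod F G => F.arity + G.arity
  | .sum F G => F.arity + G.arity

variable {a b c : Ty}

theorem map_congr {f g : a.El → b.El} {F : Func} {x : (F.app a).El}
    (h : ∀ y ∈ F.comps x, f y = g y) : F.map f x = F.map g x := by
  induction F with
  | id => exact h x (by simp [comps])
  | unit => rfl
  | int => rfl
  | prod F G ihF ihG =>
    simp only [comps, List.mem_append] at h
    exact Prod.ext (ihF fun y hy => h y (Or.inl hy)) (ihG fun y hy => h y (Or.inr hy))
  | sum F G ihF ihG =>
    cases x with
    | inl x => exact congrArg Sum.inl (ihF h)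
    | inr x => exact congrArg Sum.inr (ihG h)

theorem map_map (f : a.El → b.El) (g : b.El → c.El) {F : Func} (x : (F.app a).El) :
    F.map g (F.map f x) = F.map (fun y => g (f y)) x := by
  induction F with
  | id => rfl
  | unit => rfl
  | int => rfl
  | prod F G ihF ihG => exact Prod.ext (ihF _) (ihG _)
  | sum F G ihF ihG =>
    cases x with
    | inl x => exact congrArg Sum.inl (ihF x)
    | inr x => exact congrArg Sum.inr (ihG x)

theorem map_id {F : Func} (x : (F.app a).El) : F.map (fun y : a.El => y) x = x := by
  induction F with
  | id => rfl
  | unit => rfl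
  | int => rfl
  | prod F G ihF ihG => exact Prod.ext (ihF _) (ihG _)
  | sum F G ihF ihG =>
    cases x with
    | inl x => exact congrArg Sum.inl (ihF x)
    | inr x => exact congrArg Sum.inr (ihG x)

theorem comps_map (f : a.El → b.El) {F : Func} (x : (F.app a).El) :
    F.comps (F.map f x) = (F.comps x).map f := by
  induction F with
  | id => rfl
  | unit => rfl
  | int => rfl
  | prod F G ihF ihG => simp [comps, map, ihF, ihG]
  | sum F G ihF ihG =>
    cases x with
    | inl x => exact ihF x
    | inr x => exact ihG x

theorem length_comps_le {F : Func} (x : (F.app a).El) : (F.comps x).length ≤ F.arity := by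
  induction F with
  | id => exact le_rfl
  | unit => exact le_rfl
  | int => exact le_rfl
  | prod F G ihF ihG =>
    simp only [comps, List.length_append, arity]
    exact Nat.add_le_add (ihF _) (ihG _)
  | sum F G ihF ihG =>
    cases x with
    | inl x => exact (ihF x).trans (Nat.le_add_right _ _)
    | inr x => exact (ihG x).trans (Nat.le_add_left _ _)

theorem fits_of_mem_comps {W : ℕ} {F : Func} {x : (F.app a).El} {y : a.El} (h : Fits W (F.app a) x)
    (hy : y ∈ F.comps x) : Fits W a y := by
  induction F with
  | id =>
    obtain rfl := List.mem_singleton.1 hy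
    exact h
  | unit => simp [comps] at hy
  | int => simp [comps] at hy
  | prod F G ihF ihG =>
    have h1 := absMax_append_le.1 h.2
    rcases List.mem_append.1 hy with hy | hy
    · exact ihF ⟨(Nat.le_add_right _ _).trans h.1, h1.1⟩ hy
    · exact ihG ⟨(Nat.le_add_left _ _).trans h.1, h1.2⟩ hy
  | sum F G ihF ihG =>
    cases x with
    | inl x => exact ihF ⟨(Nat.le_succ _).trans h.1, h.2⟩ hy
    | inr x => exact ihG ⟨(Nat.le_succ _).trans h.1, h.2⟩ hy

theorem car_map (g : a.El → b.El) {F : Func} (x : (F.app (.list a)).El) :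
    F.car (a := b) (F.map (a := .list a) (b := .list b) (List.map g) x) =
      (F.car x).map (F.map g) := by
  induction F with
  | id => rfl
  | unit => rfl
  | int => rfl
  | prod F G ihF ihG =>
    simp only [car, map, ihF, ihG]
    simp only [List.product, List.map_flatMap, List.flatMap_map, List.map_map]
    rfl
  | sum F G ihF ihG =>
    cases x with
    | inl x =>
      simp only [car, map, Sum.map_inl, ihF, List.map_map]
      rfl
    | inr x =>
      simp only [car, map, Sum.map_inr, ihG, List.map_map]
      rfl

theorem car_map_subset {r r' : a.El → List b.El} {F : Func} {x : (F.app a).El}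
    (h : ∀ y ∈ F.comps x, r y ⊆ r' y) :
    F.car (a := b) (F.map (b := .list b) r x) ⊆ F.car (a := b) (F.map (b := .list b) r' x) := by
  induction F with
  | id => exact h x (by simp [comps])
  | unit => exact List.Subset.refl _
  | int => exact List.Subset.refl _
  | prod F G ihF ihG =>
    simp only [comps, List.mem_append] at h
    rintro ⟨u, v⟩ huv
    have huv' := List.pair_mem_product.1 huv
    exact List.pair_mem_product.2
      ⟨ihF (fun y hy => h y (Or.inl hy)) huv'.1, ihG (fun y hy => h y (Or.inr hy)) huv'.2⟩
  | sum F G ihF ihG =>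
    cases x with
    | inl x => exact List.map_subset _ (ihF h)
    | inr x => exact List.map_subset _ (ihG h)

theorem length_car_map_le {r : a.El → List b.El} {M : ℕ} {F : Func} {x : (F.app a).El}
    (h : ∀ y ∈ F.comps x, (r y).length ≤ M) :
    (F.car (a := b) (F.map (b := .list b) r x)).length ≤ (M + 1) ^ F.arity := by
  induction F with
  | id => exact (h x (by simp [comps])).trans (by simp [arity])
  | unit => exact le_rfl
  | int => exact le_rfl
  | prod F G ihF ihG =>
    simp only [comps, List.mem_append] at h
    have h1 := ihF fun y hy => h y (Or.inl hy)
    have h2 := ihG fun y hy => h y (Or.inr hy)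
    refine (List.length_product _ _).trans_le ?_
    rw [arity, pow_add]
    exact Nat.mul_le_mul h1 h2
  | sum F G ihF ihG =>
    cases x with
    | inl x =>
      refine (List.length_map _).trans_le ((ihF h).trans ?_)
      exact Nat.pow_le_pow_right (Nat.succ_pos _) (Nat.le_add_right _ _)
    | inr x =>
      refine (List.length_map _).trans_le ((ihG h).trans ?_)
      exact Nat.pow_le_pow_right (Nat.succ_pos _) (Nat.le_add_left _ _)

theorem fits_of_mem_car_map {r : a.El → List b.El} {W : ℕ} {F : Func} {x : (F.app a).El}
    {S M : ℕ} (hS : size (F.app a) x ≤ S) (hM : mag (F.app a) x ≤ M)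
    (h : ∀ y ∈ F.comps x, ∀ p ∈ r y, Fits W b p) {u : (F.app b).El}
    (hu : u ∈ F.car (a := b) (F.map (b := .list b) r x)) :
    size (F.app b) u ≤ S + F.arity * W ∧ mag (F.app b) u ≤ M + W := by
  induction F generalizing S with
  | id =>
    have := h x (by simp [comps]) u hu
    refine ⟨this.1.trans ?_, this.2.trans (Nat.le_add_left _ _)⟩
    simp [arity]
  | unit =>
    obtain rfl := List.mem_singleton.1 hu
    exact ⟨hS.trans (Nat.le_add_right _ _), hM.trans (Nat.le_add_right _ _)⟩
  | int =>
    obtain rfl := List.mem_singleton.1 hu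
    exact ⟨hS.trans (Nat.le_add_right _ _), hM.trans (Nat.le_add_right _ _)⟩
  | prod F G ihF ihG =>
    simp only [comps, List.mem_append] at h
    obtain ⟨u, v⟩ := u
    have huv := List.pair_mem_product.1 hu
    have h0 := absMax_append_le.1 hM
    have h1 := ihF le_rfl h0.1 (fun y hy => h y (Or.inl hy)) huv.1
    have h2 := ihG le_rfl h0.2 (fun y hy => h y (Or.inr hy)) huv.2
    refine ⟨(Nat.add_le_add h1.1 h2.1).trans ?_, absMax_append_le.2 ⟨h1.2, h2.2⟩⟩
    have h3 : size (F.app a) x.1 + size (G.app a) x.2 ≤ S := hS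
    simp only [arity, add_mul]
    omega
  | sum F G ihF ihG =>
    cases x with
    | inl x =>
      obtain ⟨u, hu', rfl⟩ := List.mem_map.1 hu
      have h1 := ihF le_rfl hM h hu'
      have h3 : size (F.app a) x + 1 ≤ S := hS
      refine ⟨(Nat.add_le_add h1.1 le_rfl).trans ?_, h1.2⟩
      simp only [arity, add_mul]
      omega
    | inr x =>
      obtain ⟨u, hu', rfl⟩ := List.mem_map.1 hu
      have h1 := ihG le_rfl hM h hu'
      have h3 : size (G.app a) x + 1 ≤ S := hS
      refine ⟨(Nat.add_le_add h1.1 le_rfl).trans ?_, h1.2⟩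
      simp only [arity, add_mul]
      omega

theorem traverse_eq_some {f : a.El → Option b.El} {g : a.El → b.El} {F : Func} {x : (F.app a).El}
    (h : ∀ y ∈ F.comps x, f y = some (g y)) : F.traverse f x = some (F.map g x) := by
  induction F with
  | id => exact h x (by simp [comps])
  | unit => rfl
  | int => rfl
  | prod F G ihF ihG =>
    simp only [comps, List.mem_append] at h
    simp only [traverse, ihF fun y hy => h y (Or.inl hy), ihG fun y hy => h y (Or.inr hy)]
    rfl
  | sum F G ihF ihG =>
    cases x with
    | inl x => simp only [traverse, ihF h]; rfl
    | inr x => simp only [traverse, ihG h]; rfl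

theorem exists_of_traverse_eq_some {f : a.El → Option b.El} {F : Func} {x : (F.app a).El}
    {T : (F.app b).El} (h : F.traverse f x = some T) : ∀ y ∈ F.comps x, ∃ v, f y = some v := by
  induction F with
  | id =>
    intro y hy
    obtain rfl := List.mem_singleton.1 hy
    exact ⟨T, h⟩
  | unit => simp [comps]
  | int => simp [comps]
  | prod F G ihF ihG =>
    simp only [traverse, Option.bind_eq_bind, Option.bind_eq_some_iff] at h
    obtain ⟨u, hu, v, hv, _⟩ := h
    intro y hy
    rcases List.mem_append.1 hy with hy | hy
    · exact ihF hu y hy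
    · exact ihG hv y hy
  | sum F G ihF ihG =>
    cases x with
    | inl x =>
      simp only [traverse, Option.bind_eq_bind, Option.bind_eq_some_iff] at h
      obtain ⟨u, hu, _⟩ := h
      exact ihF hu
    | inr x =>
      simp only [traverse, Option.bind_eq_bind, Option.bind_eq_some_iff] at h
      obtain ⟨u, hu, _⟩ := h
      exact ihG hu

end Func

theorem mapM_eq_some {α β : Type} {f : α → Option β} {g : α → β} {l : List α}
    (h : ∀ y ∈ l, f y = some (g y)) : l.mapM f = some (l.map g) := by
  induction l with
  | nil => rfl
  | cons a l ih =>
    simp only [List.mem_cons, forall_eq_or_imp] at h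
    rw [List.mapM_cons, h.1, ih h.2]
    rfl

theorem exists_of_mapM_eq_some {α β : Type} {f : α → Option β} {l : List α} {T : List β}
    (h : l.mapM f = some T) : ∀ y ∈ l, ∃ v, f y = some v := by
  induction l generalizing T with
  | nil => simp
  | cons a l ih =>
    simp only [List.mapM_cons, Option.bind_eq_bind, Option.bind_eq_some_iff] at h
    obtain ⟨u, hu, v, hv, _⟩ := h
    simp only [List.mem_cons, forall_eq_or_imp]
    exact ⟨⟨u, hu⟩, ih hv⟩

/-! ### Terminating recursive generators -/

section

variable {A B : Ty} {F : Func}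

/-- The search tree below `s` is less than `n` deep. -/
def Terminates (F : Func) (psi : B.El → List (F.app B).El) : ℕ → B.El → Prop
  | 0, _ => False
  | n + 1, s => ∀ s', Child F psi s s' → Terminates F psi n s'

/-- The value of the recursive generator `rg`, with an arbitrary value where the recursion is too
deep. -/
def gen (F : Func) (post : List A.El → List A.El)
    (phi : (F.app A).El → List A.El) (psi : B.El → List (F.app B).El) : ℕ → B.El → List A.El
  | 0, _ => []
  | n + 1, s => post (((psi s).flatMap fun t =>
      F.car (a := A) (F.map (b := .list A) (gen F post phi psi n) t)).flatMap phi)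

variable {post : List A.El → List A.El} {phi : (F.app A).El → List A.El}
  {psi : B.El → List (F.app B).El}

theorem Terminates.succ {n : ℕ} {s : B.El} (h : Terminates F psi n s) :
    Terminates F psi (n + 1) s := by
  induction n generalizing s with
  | zero => exact h.elim
  | succ n ih => exact fun s' hs' => ih (h s' hs')

theorem Terminates.of_child {n : ℕ} {s s' : B.El} (h : Terminates F psi n s)
    (hs : Child F psi s s') : Terminates F psi n s' := by
  cases n with
  | zero => exact h.elim
  | succ n => exact (h s' hs).succ

theorem Terminates.of_mem_states {n : ℕ} {i s : B.El} (h : Terminates F psi n i)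
    (hs : s ∈ states F psi i) : Terminates F psi n s := by
  replace hs : Relation.ReflTransGen (Child F psi) i s := hs
  induction hs with
  | refl => exact h
  | tail _ hc ih => exact ih.of_child hc

theorem terminates_of_rg_eq_some {n : ℕ} {s : B.El} {L : List A.El}
    (h : rg F post phi psi n s = some L) : Terminates F psi n s := by
  induction n generalizing s L with
  | zero => simp [rg] at h
  | succ n ih =>
    simp only [rg, Option.bind_eq_bind, Option.bind_eq_some_iff] at h
    obtain ⟨Ls, hLs, _⟩ := h
    rintro s' ⟨t, ht, hs'⟩
    obtain ⟨T, hT⟩ := exists_of_mapM_eq_some hLs t ht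
    obtain ⟨v, hv⟩ := Func.exists_of_traverse_eq_some hT s' hs'
    exact ih hv

theorem Terminates.rg_eq {n : ℕ} {s : B.El} (h : Terminates F psi n s) :
    rg F post phi psi n s = some (gen F post phi psi n s) := by
  induction n generalizing s with
  | zero => exact h.elim
  | succ n ih =>
    have h1 : (psi s).mapM (fun t => F.traverse (b := .list A) (rg F post phi psi n) t) =
        some ((psi s).map fun t => F.map (b := .list A) (gen F post phi psi n) t) :=
      mapM_eq_some fun t ht => Func.traverse_eq_some fun s' hs' => ih (h s' ⟨t, ht, hs'⟩)
    simp only [rg, gen, h1, ← List.flatMap_map]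
    rfl

theorem Terminates.gen_succ {n : ℕ} {s : B.El} (h : Terminates F psi n s) :
    gen F post phi psi (n + 1) s = gen F post phi psi n s := by
  induction n generalizing s with
  | zero => exact h.elim
  | succ n ih =>
    rw [gen]
    conv_rhs => rw [gen]
    congr 2
    refine List.flatMap_congr fun t ht => congrArg _ (Func.map_congr fun s' hs' =>
      ih (h s' ⟨t, ht, hs'⟩))

/-- Where the recursion terminates, the generator is a fixed point of its defining equation. -/
theorem Terminates.gen_eq {n : ℕ} {s : B.El} (h : Terminates F psi n s) :
    gen F post phi psi n s = post (((psi s).flatMap fun t =>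
      F.car (a := A) (F.map (b := .list A) (gen F post phi psi n) t)).flatMap phi) :=
  h.gen_succ.symm

theorem mem_phiInputs {n : ℕ} {s : B.El} (h : ∀ s', Child F psi s s' → Terminates F psi n s')
    {t : (F.app B).El} (ht : t ∈ psi s) {u : (F.app A).El}
    (hu : u ∈ F.car (a := A) (F.map (b := .list A) (gen F post phi psi n) t)) :
    u ∈ phiInputs F post phi psi s :=
  ⟨t, ht, n, _, Func.traverse_eq_some fun s' hs' => (h s' ⟨t, ht, hs'⟩).rg_eq, hu⟩

/-- Discarding some of the results in each invocation only removes results. -/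
theorem gen_subset {post' : List A.El → List A.El} (hpost : ∀ S, post S ⊆ S)
    (hpost' : ∀ S, S ⊆ post' S)
    (n : ℕ) (s : B.El) : gen F post phi psi n s ⊆ gen F post' phi psi n s := by
  induction n generalizing s with
  | zero => exact List.Subset.refl _
  | succ n ih =>
    refine List.Subset.trans (hpost _) (List.Subset.trans ?_ (hpost' _))
    intro p hp
    simp only [List.mem_flatMap] at hp ⊢
    obtain ⟨u, ⟨t, ht, hu⟩, hp⟩ := hp
    exact ⟨u, ⟨t, ht, Func.car_map_subset (fun y _ => ih y) hu⟩, hp⟩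

end

/-! ### Thinning -/

section

variable {A : Ty} {R : List (Cmp A)}

theorem thin_subset (S : List A.El) : (thin R S).1 ⊆ S := by
  induction S with
  | nil => exact List.Subset.refl _
  | cons p S ih =>
    intro x hx
    simp only [thin] at hx
    split_ifs at hx with h
    · exact List.mem_cons_of_mem _ (ih hx)
    · rw [List.mem_orderedInsert, List.mem_filter] at hx
      rcases hx with rfl | hx
      · exact List.mem_cons_self
      · exact List.mem_cons_of_mem _ (ih hx.1)

theorem dominated_of_keyVec_eq {p q : A.El} (h : keyVec R p = keyVec R q) :
    dominated R p q = true := by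
  simp only [keyVec, List.map_inj_left] at h
  simp only [dominated, List.all_eq_true]
  intro c hc
  simp [Cmp.holds, h c hc]

theorem pairwise_thin (S : List A.El) :
    (thin R S).1.Pairwise fun a b => keyVec R a ≤ keyVec R b := by
  induction S with
  | nil => exact List.Pairwise.nil
  | cons p S ih =>
    simp only [thin]
    split_ifs with h
    · exact ih
    · have : Std.Total fun a b : A.El => keyVec R a ≤ keyVec R b :=
        ⟨fun a b => le_total (keyVec R a) (keyVec R b)⟩
      have : IsTrans A.El fun a b => keyVec R a ≤ keyVec R b :=
        ⟨fun a b c => le_trans (a := keyVec R a)⟩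
      exact (ih.filter _).orderedInsert _ _

theorem nodup_map_keyVec_thin (S : List A.El) : ((thin R S).1.map (keyVec R)).Nodup := by
  induction S with
  | nil => exact List.nodup_nil
  | cons p S ih =>
    simp only [thin]
    split_ifs with h
    · exact ih
    · rw [((List.perm_orderedInsert _ _ _).map _).nodup_iff, List.map_cons, List.nodup_cons]
      refine ⟨fun hp => ?_, ih.sublist (List.filter_sublist.map _)⟩
      obtain ⟨q, hq, hqp⟩ := List.mem_map.1 hp
      exact h (List.any_eq_true.2
        ⟨q, (List.mem_filter.1 hq).1, dominated_of_keyVec_eq hqp.symm⟩)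

theorem nodup_thin (S : List A.El) : (thin R S).1.Nodup := (nodup_map_keyVec_thin S).of_map _

/-- A thinned list is in strictly increasing order of its key vectors, and hence determined by its
elements. -/
theorem thin_eq_of_mem_iff {S S' : List A.El} (h : ∀ p, p ∈ (thin R S).1 ↔ p ∈ (thin R S').1) :
    (thin R S).1 = (thin R S').1 := by
  refine List.Perm.eq_of_pairwise (le := fun a b => keyVec R a ≤ keyVec R b) ?_ (pairwise_thin S)
    (pairwise_thin S') ((List.perm_ext_iff_of_nodup (nodup_thin S) (nodup_thin S')).2 h)
  intro a b ha hb hab hba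
  exact List.inj_on_of_nodup_map (nodup_map_keyVec_thin S) ha ((h b).2 hb) (le_antisymm hab hba)

theorem length_thin_le (S : List A.El) : (thin R S).1.length ≤ S.length :=
  ((nodup_thin S).subperm (thin_subset S)).length_le

theorem cost_thin_le {C : ℕ} {S : List A.El}
    (h : ∀ p ∈ S, (R.map fun c => c.key.cost p ()).sum ≤ C) :
    (thin R S).2 ≤ 1 + S.length * (C + 3 * (S.length + 1) * (R.length + 1)) := by
  induction S with
  | nil => simp [thin]
  | cons p S ih =>
    simp only [List.mem_cons, forall_eq_or_imp] at h
    have h1 := ih h.2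
    have h2 := h.1
    have h3 : 3 * ((thin R S).1.length + 1) * (R.length + 1) ≤
        3 * (S.length + 1 + 1) * (R.length + 1) := by
      have := length_thin_le (R := R) S
      gcongr
      omega
    have h4 : S.length * (C + 3 * (S.length + 1) * (R.length + 1)) ≤
        S.length * (C + 3 * (S.length + 1 + 1) * (R.length + 1)) := by
      gcongr
      omega
    simp only [thin, List.length_cons]
    rw [add_mul S.length 1]
    omega

theorem thin_map {A' : Ty} {R' : List (Cmp A')} (g : A.El → A'.El) {S : List A.El}
    (hd : ∀ p ∈ S, ∀ q ∈ S, dominated R' (g p) (g q) = dominated R p q)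
    (hk : ∀ p ∈ S, keyVec R' (g p) = keyVec R p) :
    (thin R' (S.map g)).1 = (thin R S).1.map g := by
  induction S with
  | nil => rfl
  | cons p S ih =>
    have hS := thin_subset (R := R) S
    have h1 := ih (fun p hp q hq => hd p (List.mem_cons_of_mem _ hp) q (List.mem_cons_of_mem _ hq))
      fun p hp => hk p (List.mem_cons_of_mem _ hp)
    have hany : (((thin R S).1.map g).any fun q => dominated R' (g p) q) =
        (thin R S).1.any fun q => dominated R p q := by
      rw [List.any_map]
      rw [Bool.eq_iff_iff, List.any_eq_true, List.any_eq_true]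
      exact exists_congr fun q => and_congr_right fun hq => by
        rw [Function.comp, hd p List.mem_cons_self q (List.mem_cons_of_mem _ (hS hq))]
    have hfil : ((thin R S).1.map g).filter (fun q => !dominated R' q (g p)) =
        ((thin R S).1.filter fun q => !dominated R q p).map g := by
      rw [List.filter_map]
      congr 1
      refine List.filter_congr fun q hq => ?_
      simp only [Function.comp, hd q (List.mem_cons_of_mem _ (hS hq)) p List.mem_cons_self]
    simp only [List.map_cons, thin, h1, hany, hfil]
    split_ifs
    · rfl
    · refine (List.map_orderedInsert (r := fun a b => keyVec R a ≤ keyVec R b)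
        (s := fun a b => keyVec R' a ≤ keyVec R' b) g _ _ ?_ ?_).symm
      · intro q hq
        have hq' := hS (List.mem_filter.1 hq).1
        rw [hk p List.mem_cons_self, hk q (List.mem_cons_of_mem _ hq')]
      · intro q hq
        have hq' := hS (List.mem_filter.1 hq).1
        rw [hk p List.mem_cons_self, hk q (List.mem_cons_of_mem _ hq')]

end

/-! ### Depth-first search with memoized keys -/

section

variable {X κ : Type} [DecidableEq κ]

/-- A depth-first search that visits the nodes in a list, and skips the nodes whose key has been
seen. `Dfs kids key xs M M' l` says that the search of `xs` terminates and turns the set `M` of seen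
keys into `M'`; `l` lists the expanded nodes, in the order in which they are entered, with the set
of keys seen at that moment. The key of a node is added only after its children have been
visited. -/
inductive Dfs (kids : X → List X) (key : X → κ) :
    List X → Finset κ → Finset κ → List (X × Finset κ) → Prop
  | nil (M : Finset κ) : Dfs kids key [] M M []
  | hit {x : X} {xs : List X} {M M' : Finset κ} {l : List (X × Finset κ)} :
      key x ∈ M → Dfs kids key xs M M' l → Dfs kids key (x :: xs) M M' l
  | miss {x : X} {xs : List X} {M M₁ M₂ : Finset κ} {l₁ l₂ : List (X × Finset κ)} :
      key x ∉ M → Dfs kids key (kids x) M M₁ l₁ → Dfs kids key xs (insert (key x) M₁) M₂ l₂ →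
      Dfs kids key (x :: xs) M M₂ ((x, M) :: (l₁ ++ l₂))

namespace Dfs

variable {kids : X → List X} {key : X → κ} {xs ys : List X} {M M' M'' : Finset κ}
  {l l' : List (X × Finset κ)}

theorem append (h : Dfs kids key xs M M' l) (h' : Dfs kids key ys M' M'' l') :
    Dfs kids key (xs ++ ys) M M'' (l ++ l') := by
  induction h with
  | nil => exact h'
  | hit hx _ ih => exact .hit hx (ih h')
  | miss hx h₁ _ _ ih =>
    rw [List.cons_append, List.cons_append, List.append_assoc]
    exact .miss hx h₁ (ih h')

theorem log_unique (h : Dfs kids key xs M M' l) (h' : Dfs kids key xs M M'' l') :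
    M' = M'' ∧ l = l' := by
  induction h generalizing M'' l' with
  | nil => cases h'; exact ⟨rfl, rfl⟩
  | hit hx _ ih =>
    cases h' with
    | hit _ h' => exact ih h'
    | miss hx' => exact absurd hx hx'
  | miss hx h₁ h₂ ih₁ ih₂ =>
    cases h' with
    | hit hx' => exact absurd hx' hx
    | miss _ h₁' h₂' =>
      obtain ⟨rfl, rfl⟩ := ih₁ h₁'
      obtain ⟨rfl, rfl⟩ := ih₂ h₂'
      exact ⟨rfl, rfl⟩

theorem subset (h : Dfs kids key xs M M' l) : M ⊆ M' := by
  induction h with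
  | nil => exact Finset.Subset.refl _
  | hit _ _ ih => exact ih
  | miss _ _ _ ih₁ ih₂ =>
    exact ih₁.trans ((Finset.subset_insert _ _).trans ih₂)

theorem of_mem_log (h : Dfs kids key xs M M' l) {y : X × Finset κ} (hy : y ∈ l) :
    M ⊆ y.2 ∧ y.2 ⊆ M' ∧ key y.1 ∉ y.2 ∧ key y.1 ∈ M' := by
  induction h with
  | nil => simp at hy
  | hit _ _ ih => exact ih hy
  | @miss x xs M M₁ M₂ l₁ l₂ hx h₁ h₂ ih₁ ih₂ =>
    have hM : insert (key x) M₁ ⊆ M₂ := h₂.subset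
    have hM' : M₁ ⊆ M₂ := (Finset.subset_insert _ _).trans hM
    simp only [List.mem_cons, List.mem_append] at hy
    rcases hy with rfl | hy | hy
    · exact ⟨Finset.Subset.refl _, h₁.subset.trans hM', hx, hM (Finset.mem_insert_self _ _)⟩
    · obtain ⟨e₁, e₂, e₃, e₄⟩ := ih₁ hy
      exact ⟨e₁, e₂.trans hM', e₃, hM' e₄⟩
    · obtain ⟨e₁, e₂, e₃, e₄⟩ := ih₂ hy
      exact ⟨h₁.subset.trans ((Finset.subset_insert _ _).trans e₁), e₂, e₃, e₄⟩

/-- The search below each expanded node is a part of the whole search. -/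
theorem exists_of_mem_log (h : Dfs kids key xs M M' l) {y : X × Finset κ} (hy : y ∈ l) :
    ∃ M₁ l₁, Dfs kids key [y.1] y.2 M₁ l₁ ∧ l₁.length ≤ l.length := by
  induction h with
  | nil => simp at hy
  | hit _ _ ih => exact ih hy
  | miss hx h₁ h₂ ih₁ ih₂ =>
    simp only [List.mem_cons, List.mem_append] at hy
    rcases hy with rfl | hy | hy
    · exact ⟨_, _, .miss hx h₁ (.nil _), by simp⟩
    · obtain ⟨M₃, l₃, h₃, hl⟩ := ih₁ hy
      exact ⟨M₃, l₃, h₃, hl.trans (by simp; omega)⟩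
    · obtain ⟨M₃, l₃, h₃, hl⟩ := ih₂ hy
      exact ⟨M₃, l₃, h₃, hl.trans (by simp; omega)⟩

/-- No node is expanded twice with the same set of seen keys. A second expansion inside the first
one would repeat the search below the node within itself; a second expansion after the first one
finds the key of the node in the set. -/
theorem pairwise_log (h : Dfs kids key xs M M' l) : l.Pairwise fun a b => a ≠ b ∧ a.2 ⊆ b.2 := by
  induction h with
  | nil => exact List.Pairwise.nil
  | hit _ _ ih => exact ih
  | @miss x xs M M₁ M₂ l₁ l₂ hx h₁ h₂ ih₁ ih₂ =>
    rw [List.pairwise_cons, List.pairwise_append]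
    refine ⟨fun y hy => ?_, ih₁, ih₂, fun y hy z hz => ?_⟩
    · rcases List.mem_append.1 hy with hy | hy
      · refine ⟨?_, (h₁.of_mem_log hy).1⟩
        rintro rfl
        -- the search below `x` with keys `M` is unique, but would be logged inside its own log `l₁`
        obtain ⟨M₃, l₃, h₃, hl⟩ := h₁.exists_of_mem_log hy
        have := (h₃.log_unique (.miss hx h₁ (.nil _))).2
        rw [this] at hl
        simp at hl
      · have hM := (h₂.of_mem_log hy).1
        refine ⟨?_, h₁.subset.trans ((Finset.subset_insert _ _).trans hM)⟩
        rintro rfl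
        exact hx (hM (Finset.mem_insert_self _ _))
    · have hM : M₁ ⊆ z.2 := (Finset.subset_insert _ _).trans (h₂.of_mem_log hz).1
      have hy' := h₁.of_mem_log hy
      refine ⟨?_, hy'.2.1.trans hM⟩
      rintro rfl
      exact hy'.2.2.1 (hM hy'.2.2.2)

theorem subset_union_image (h : Dfs kids key xs M M' l) {s : Finset X} (hs : ∀ y ∈ l, y.1 ∈ s) :
    M' ⊆ M ∪ s.image key := by
  induction h with
  | nil => exact Finset.subset_union_left
  | hit _ _ ih => exact ih hs
  | @miss x xs M M₁ M₂ l₁ l₂ hx h₁ h₂ ih₁ ih₂ =>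
    simp only [List.mem_cons, List.mem_append] at hs
    refine (ih₂ fun y hy => hs y (Or.inr (Or.inr hy))).trans (Finset.union_subset ?_
      Finset.subset_union_right)
    refine Finset.insert_subset ?_ (ih₁ fun y hy => hs y (Or.inr (Or.inl hy)))
    exact Finset.mem_union_right _ (Finset.mem_image_of_mem _ (hs (x, M) (Or.inl rfl)))

/-- The sets of seen keys form a chain, so that there are at most `s.card + 1` of them, and an
expanded node is determined by its place in `s` and the number of seen keys. -/
theorem length_log_le (h : Dfs kids key xs ∅ M' l) {s : Finset X} (hs : ∀ y ∈ l, y.1 ∈ s) :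
    l.length ≤ s.card * (s.card + 1) := by
  classical
  have hnd : (l.map fun y => (y.1, y.2.card)).Nodup := by
    rw [List.Nodup, List.pairwise_map]
    refine h.pairwise_log.imp fun {a b} hab hab' => hab.1 ?_
    have h' := Prod.ext_iff.1 hab'
    exact Prod.ext h'.1 (Finset.eq_of_subset_of_card_le hab.2 h'.2.ge)
  have hsub : (l.map fun y => (y.1, y.2.card)).toFinset ⊆ s ×ˢ Finset.range (s.card + 1) := by
    intro z hz
    obtain ⟨y, hy, rfl⟩ := List.mem_map.1 (List.mem_toFinset.1 hz)
    refine Finset.mem_product.2 ⟨hs y hy, Finset.mem_range.2 (Nat.lt_succ_of_le ?_)⟩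
    refine (Finset.card_le_card ((h.of_mem_log hy).2.1.trans (h.subset_union_image hs))).trans ?_
    rw [Finset.empty_union]
    exact Finset.card_image_le
  have := Finset.card_le_card hsub
  rw [List.toFinset_card_of_nodup hnd, List.length_map, Finset.card_product,
    Finset.card_range] at this
  exact this

end Dfs

end

/-! ### Execution of memoized programs -/

section

variable {F : Func} {A B : Ty}

/-- The tuple of keys of a state. -/
def Prog.key (P : Prog F B A) (s : B.El) : List ℤ := P.keys.map fun k => k.val s ()

/-- The substates on which the recursion is invoked, in the order of their invocation. -/
def Prog.kids (P : Prog F B A) (s : B.El) : List B.El := (P.psi.out s).flatMap (F.comps (a := B))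

/-- The steps spent on keys and on buffer look-up in one invocation. -/
def Prog.invokeCost (P : Prog F B A) (s : B.El) (len : ℕ) : ℕ :=
  1 + (P.keys.map fun k => k.cost s ()).sum + (len + 1) * (P.keys.length + 1)

/-- The steps spent on combining the results of the substates. -/
def Prog.combineCost (P : Prog F B A) (us : List (F.app A).El) : ℕ :=
  (us.map fun u => size (F.app A) u + P.phi.cost u).sum +
    (thin P.cmps (us.flatMap P.phi.out)).2 + 1

/-- A buffer hit costs the invocation only. -/
theorem Prog.exec_of_find?_eq_some (P : Prog F B A) (n : ℕ) {s : B.El}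
    {buf : List (Entry B A)} {c : ℕ} {e : Entry B A}
    (h : buf.find? (fun e => e.key = P.key s) = some e) :
    (P.exec (n + 1) s).run (buf, c) = some (e.result, (buf, c + P.invokeCost s buf.length)) := by
  simp only [Prog.exec, tick, StateT.run_bind, StateT.run_modify, StateT.run_get, Option.pure_def,
    Option.bind_eq_bind, Option.bind_some, Prog.invokeCost, Nat.add_assoc]
  erw [h]
  rfl

/-- A buffer miss runs the recursion on the substates, and stores the result after that. -/
theorem Prog.exec_of_find?_eq_none (P : Prog F B A) (n : ℕ) {s : B.El}
    {buf buf' : List (Entry B A)} {c c' : ℕ} {Ls : List (F.app (.list A)).El}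
    (h : buf.find? (fun e => e.key = P.key s) = none)
    (hLs : ((P.psi.out s).mapM fun t => F.traverse (b := .list A) (P.exec n) t).run
      (buf, c + P.invokeCost s buf.length + P.psi.cost s) = some (Ls, (buf', c'))) :
    (P.exec (n + 1) s).run (buf, c) =
      some ((thin P.cmps ((Ls.flatMap (F.car (a := A))).flatMap P.phi.out)).1,
        (⟨s, P.key s, (thin P.cmps ((Ls.flatMap (F.car (a := A))).flatMap P.phi.out)).1⟩ :: buf',
          c' + P.combineCost (Ls.flatMap (F.car (a := A))))) := by
  simp only [Prog.invokeCost, ← Nat.add_assoc] at hLs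
  simp only [Prog.exec, tick, StateT.run_bind, StateT.run_modify, StateT.run_get, Option.pure_def,
    Option.bind_eq_bind, Option.bind_some, Prog.combineCost, ← Nat.add_assoc]
  erw [h]
  simp only [StateT.run_bind, StateT.run_modify, Option.pure_def, Option.bind_eq_bind,
    Option.bind_some, hLs, StateT.run_pure]
  rfl

end

/-! ### Simulation of a memoized program on converted states -/

section

variable {F : Func} {A B B' : Ty}

/-- The program `P'` on converted states simulates `P`: `f` is the conversion of states, `res` the
result of `P` on a state, `S` contains the states of the search tree, and `Ex` and `Inv` those on
which `P'` is known to agree with `P` when they are expanded and invoked, respectively. The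
numbers bound the steps of `P'` on keys, on `psi`, on combining results, and the number of
substates. -/
structure Simulates (P : Prog F B A) (P' : Prog F B' A) (f : B.El → B'.El)
    (res : B.El → List A.El) (S Ex Inv : Set B.El) (cKey cPsi cComb nKids : ℕ) : Prop where
  phi_eq : P'.phi = P.phi
  cmps_eq : P'.cmps = P.cmps
  child_mem : ∀ s ∈ S, ∀ s', Child F P.psi.out s s' → s' ∈ S
  child_mem_inv : ∀ s ∈ Ex, ∀ s', Child F P.psi.out s s' → s' ∈ Inv
  res_eq : ∀ s ∈ S, res s = (thin P.cmps (((P.psi.out s).flatMap fun t =>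
    F.car (a := A) (F.map (b := .list A) res t)).flatMap P.phi.out)).1
  res_congr : ∀ s ∈ S, ∀ s' ∈ S, P.key s = P.key s' → res s = res s'
  out_eq : ∀ s ∈ Ex, P'.psi.out (f s) = (P.psi.out s).map (F.map f)
  key_eq : ∀ s ∈ Inv, P'.key (f s) = P.key s
  key_cost_le : ∀ s ∈ S, (P'.keys.map fun k => k.cost (f s) ()).sum ≤ cKey
  psi_cost_le : ∀ s ∈ S, s ∈ Ex → P'.psi.cost (f s) ≤ cPsi
  combine_cost_le : ∀ s ∈ S, P'.combineCost ((P.psi.out s).flatMap fun t =>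
    F.car (a := A) (F.map (b := .list A) res t)) ≤ cComb
  length_kids_le : ∀ s ∈ S, (P.kids s).length ≤ nKids

/-- The records of the buffer are correct. -/
def GoodBuffer (P : Prog F B A) (res : B.El → List A.El) (S : Set B.El)
    (buf : List (Entry B A)) : Prop :=
  ∀ e ∈ buf, e.state ∈ S ∧ e.key = P.key e.state ∧ e.result = res e.state

/-- The record with its state converted. -/
def Entry.conv (f : B.El → B'.El) (e : Entry B A) : Entry B' A := ⟨f e.state, e.key, e.result⟩

/-- The keys in the buffer. -/
def keySet (buf : List (Entry B A)) : Finset (List ℤ) := (buf.map Entry.key).toFinset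

/-- The steps of one invocation when the buffer has at most `E` records. -/
def invokeBound (P' : Prog F B' A) (cKey E : ℕ) : ℕ :=
  1 + cKey + (E + 1) * (P'.keys.length + 1)

/-- The steps of one expansion, including those of the invocations on the substates. -/
def expandBound (P' : Prog F B' A) (cKey cPsi cComb nKids E : ℕ) : ℕ :=
  cPsi + cComb + nKids * invokeBound P' cKey E

/-- The computation `m` of `P`, which invokes the recursion on the states `ks`, returns `v`, and is
simulated by the computation `m'` of `P'`, provided that `P'` agrees with `P` where it is needed.
The search done by `m'` is recorded as a depth-first search. -/
def Sim (P : Prog F B A) (P' : Prog F B' A) (f : B.El → B'.El) (res : B.El → List A.El)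
    (S Ex Inv : Set B.El) (cKey cPsi cComb nKids : ℕ) {α : Type} (m : Exec B A α)
    (m' : Exec B' A α) (v : α) (ks : List B.El) : Prop :=
  ∀ buf c, GoodBuffer P res S buf → ∃ new c₁,
    m.run (buf, c) = some (v, (new ++ buf, c₁)) ∧ GoodBuffer P res S new ∧
    ((∀ e ∈ new, e.state ∈ Ex) → (∀ s ∈ ks, s ∈ Inv) → ∀ c', ∃ c₁' log,
      m'.run (buf.map (Entry.conv f), c') = some (v, ((new ++ buf).map (Entry.conv f), c₁')) ∧
      Dfs P'.kids P'.key (ks.map f) (keySet buf) (keySet (new ++ buf)) log ∧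
      log.length = new.length ∧ (∀ y ∈ log, ∃ s ∈ S, f s = y.1) ∧
      ∀ E, (new ++ buf).length ≤ E → c₁' ≤ c' + ks.length * invokeBound P' cKey E +
        new.length * expandBound P' cKey cPsi cComb nKids E)

variable {P : Prog F B A} {P' : Prog F B' A} {f : B.El → B'.El} {res : B.El → List A.El}
  {S Ex Inv : Set B.El} {cKey cPsi cComb nKids : ℕ} {α β : Type}

theorem GoodBuffer.append {buf new : List (Entry B A)} (h : GoodBuffer P res S new)
    (h' : GoodBuffer P res S buf) : GoodBuffer P res S (new ++ buf) := by
  intro e he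
  rcases List.mem_append.1 he with he | he
  exacts [h e he, h' e he]

namespace Sim

theorem pure (v : α) :
    Sim P P' f res S Ex Inv cKey cPsi cComb nKids (Pure.pure v) (Pure.pure v) v [] := by
  intro buf c _
  refine ⟨[], c, rfl, by simp [GoodBuffer], fun _ _ c' => ⟨c', [], rfl, .nil _, rfl, by simp,
    fun E _ => by simp⟩⟩

theorem bind {m : Exec B A α} {m' : Exec B' A α} {v : α} {ks : List B.El} {k : α → Exec B A β}
    {k' : α → Exec B' A β} {w : β} {ks' : List B.El}
    (h : Sim P P' f res S Ex Inv cKey cPsi cComb nKids m m' v ks)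
    (h' : Sim P P' f res S Ex Inv cKey cPsi cComb nKids (k v) (k' v) w ks') :
    Sim P P' f res S Ex Inv cKey cPsi cComb nKids (m >>= k) (m' >>= k') w (ks ++ ks') := by
  intro buf c hbuf
  obtain ⟨new, c₁, hm, hnew, H⟩ := h buf c hbuf
  obtain ⟨new', c₂, hk, hnew', H'⟩ := h' (new ++ buf) c₁ (hnew.append hbuf)
  refine ⟨new' ++ new, c₂, ?_, hnew'.append hnew, fun hEx hInv c' => ?_⟩
  · rw [StateT.run_bind, hm]
    simpa using hk
  · simp only [List.mem_append] at hEx hInv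
    obtain ⟨c₁', log, e₁, e₂, e₃, e₄, e₅⟩ :=
      H (fun e he => hEx e (Or.inr he)) (fun s hs => hInv s (Or.inl hs)) c'
    obtain ⟨c₂', log', e₁', e₂', e₃', e₄', e₅'⟩ :=
      H' (fun e he => hEx e (Or.inl he)) (fun s hs => hInv s (Or.inr hs)) c₁'
    refine ⟨c₂', log ++ log', ?_, ?_, ?_, ?_, fun E hE => ?_⟩
    · rw [StateT.run_bind, e₁]
      simpa using e₁'
    · rw [List.map_append, List.append_assoc]
      exact e₂.append e₂'
    · simp only [List.length_append, e₃, e₃', Nat.add_comm]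
    · intro y hy
      rcases List.mem_append.1 hy with hy | hy
      exacts [e₄ y hy, e₄' y hy]
    · have h₁ := e₅' E (by rwa [← List.append_assoc])
      have h₂ := e₅ E (by simp only [List.length_append] at hE ⊢; omega)
      simp only [List.length_append, add_mul]
      omega

theorem traverse {r : B.El → Exec B A (List A.El)} {r' : B'.El → Exec B' A (List A.El)}
    {G : Func} {t : (G.app B).El}
    (h : ∀ s ∈ G.comps t,
      Sim P P' f res S Ex Inv cKey cPsi cComb nKids (r s) (r' (f s)) (res s) [s]) :
    Sim P P' f res S Ex Inv cKey cPsi cComb nKids (G.traverse (b := .list A) r t)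
      (G.traverse (b := .list A) r' (G.map f t)) (G.map (b := .list A) res t) (G.comps t) := by
  induction G with
  | id => exact h t (List.mem_singleton_self t)
  | unit => exact Sim.pure t
  | int => exact Sim.pure t
  | prod G H ihG ihH =>
    have h₁ := ihG fun s hs => h s (List.mem_append_left _ hs)
    have h₂ := ihH fun s hs => h s (List.mem_append_right _ hs)
    have := h₁.bind (k := fun y => H.traverse (b := .list A) r t.2 >>= fun z => Pure.pure (y, z))
      (k' := fun y => H.traverse (b := .list A) r' (H.map f t.2) >>= fun z => Pure.pure (y, z))
      (h₂.bind (k := fun z => Pure.pure (_, z)) (k' := fun z => Pure.pure (_, z)) (Sim.pure _))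
    rwa [List.append_nil] at this
  | sum G H ihG ihH =>
    cases t with
    | inl t =>
      have := (ihG h).bind (k := fun y => Pure.pure (Sum.inl y))
        (k' := fun y => Pure.pure (Sum.inl y))
        (w := (Sum.inl (G.map (b := .list A) res t) : ((Func.sum G H).app (.list A)).El))
        (Sim.pure _)
      rwa [List.append_nil] at this
    | inr t =>
      have := (ihH h).bind (k := fun y => Pure.pure (Sum.inr y))
        (k' := fun y => Pure.pure (Sum.inr y))
        (w := (Sum.inr (H.map (b := .list A) res t) : ((Func.sum G H).app (.list A)).El))
        (Sim.pure _)
      rwa [List.append_nil] at this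

theorem mapM {τ τ' : Type} {r : τ → Exec B A β} {r' : τ' → Exec B' A β} {g : τ → τ'} {v : τ → β}
    {ks : τ → List B.El} {l : List τ}
    (h : ∀ t ∈ l, Sim P P' f res S Ex Inv cKey cPsi cComb nKids (r t) (r' (g t)) (v t) (ks t)) :
    Sim P P' f res S Ex Inv cKey cPsi cComb nKids (l.mapM r) ((l.map g).mapM r') (l.map v)
      (l.flatMap ks) := by
  induction l with
  | nil => exact Sim.pure _
  | cons t l ih =>
    simp only [List.mem_cons, forall_eq_or_imp] at h
    rw [List.map_cons, List.mapM_cons, List.mapM_cons]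
    have := h.1.bind (k := fun y => l.mapM r >>= fun z => Pure.pure (y :: z))
      (k' := fun y => (l.map g).mapM r' >>= fun z => Pure.pure (y :: z))
      ((ih h.2).bind (k := fun z => Pure.pure (_ :: z)) (k' := fun z => Pure.pure (_ :: z))
        (Sim.pure _))
    rwa [List.append_nil] at this

end Sim

theorem mem_keySet {buf : List (Entry B A)} {k : List ℤ} :
    k ∈ keySet buf ↔ ∃ e ∈ buf, e.key = k := by
  simp [keySet]

/-- A buffer hit leaves the search unchanged; after a miss, the substates are searched with the same
buffer before the record of the state is added. -/
theorem Simulates.sim (H : Simulates P P' f res S Ex Inv cKey cPsi cComb nKids) {n : ℕ} {s : B.El}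
    (hs : s ∈ S) (hn : Terminates F P.psi.out n s) :
    Sim P P' f res S Ex Inv cKey cPsi cComb nKids (P.exec n s) (P'.exec n (f s)) (res s) [s] := by
  induction n generalizing s with
  | zero => exact hn.elim
  | succ n ih =>
    have hsim : Sim P P' f res S Ex Inv cKey cPsi cComb nKids
        ((P.psi.out s).mapM fun t => F.traverse (b := .list A) (P.exec n) t)
        (((P.psi.out s).map (F.map f)).mapM fun t => F.traverse (b := .list A) (P'.exec n) t)
        ((P.psi.out s).map (F.map (b := .list A) res)) (P.kids s) :=
      Sim.mapM fun t ht => Sim.traverse fun s' hs' =>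
        ih (H.child_mem s hs s' ⟨t, ht, hs'⟩) (hn s' ⟨t, ht, hs'⟩)
    have hconv : ∀ buf : List (Entry B A), s ∈ Inv →
        (buf.map (Entry.conv f)).find? (fun e => e.key = P'.key (f s)) =
          (buf.find? fun e => e.key = P.key s).map (Entry.conv f) := by
      intro buf hInv
      rw [List.find?_map, H.key_eq s hInv]
      rfl
    have hinvoke : ∀ buf : List (Entry B A), ∀ E, buf.length ≤ E →
        P'.invokeCost (f s) (buf.map (Entry.conv f)).length ≤ invokeBound P' cKey E := by
      intro buf E hE
      have := H.key_cost_le s hs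
      rw [List.length_map]
      unfold Prog.invokeCost invokeBound
      gcongr
    intro buf c hbuf
    cases hfind : buf.find? fun e => e.key = P.key s with
    | some e =>
      have hmem := List.mem_of_find?_eq_some hfind
      have hkey : e.key = P.key s := by simpa using List.find?_some hfind
      have hgood := hbuf e hmem
      have hres : e.result = res s :=
        hgood.2.2.trans (H.res_congr _ hgood.1 _ hs (hgood.2.1.symm.trans hkey))
      refine ⟨[], _, hres ▸ P.exec_of_find?_eq_some n hfind, by simp [GoodBuffer],
        fun _ hInv c' => ?_⟩
      have hsInv := hInv s (List.mem_singleton_self s)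
      have hfind' : (buf.map (Entry.conv f)).find? (fun e => e.key = P'.key (f s)) =
          some (Entry.conv f e) := by
        rw [hconv _ hsInv, hfind]
        rfl
      refine ⟨_, [], hres ▸ P'.exec_of_find?_eq_some n hfind', ?_, rfl, by simp, fun E hE => ?_⟩
      · refine .hit ?_ (.nil _)
        rw [H.key_eq s hsInv]
        exact mem_keySet.2 ⟨e, hmem, hkey⟩
      · have := hinvoke buf E hE
        simp only [List.length_cons, List.length_nil]
        omega
    | none =>
      obtain ⟨new, c₁, hm, hnew, Hm⟩ := hsim buf (c + P.invokeCost s buf.length + P.psi.cost s) hbuf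
      have hus : ((P.psi.out s).map (F.map (b := .list A) res)).flatMap (F.car (a := A)) =
          (P.psi.out s).flatMap fun t => F.car (a := A) (F.map (b := .list A) res t) :=
        List.flatMap_map ..
      have hrun := P.exec_of_find?_eq_none n hfind hm
      rw [hus, ← H.res_eq s hs] at hrun
      refine ⟨⟨s, P.key s, res s⟩ :: new, _, hrun, ?_, fun hEx hInv c' => ?_⟩
      · intro e he
        rcases List.mem_cons.1 he with rfl | he
        · exact ⟨hs, rfl, rfl⟩
        · exact hnew e he
      · have hsInv := hInv s (List.mem_singleton_self s)
        simp only [List.mem_cons, forall_eq_or_imp] at hEx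
        have hkids : ∀ s' ∈ P.kids s, s' ∈ Inv := by
          intro s' hs'
          obtain ⟨t, ht, hs'⟩ := List.mem_flatMap.1 hs'
          exact H.child_mem_inv s hEx.1 s' ⟨t, ht, hs'⟩
        obtain ⟨c₁', log, e₁, e₂, e₃, e₄, e₅⟩ := Hm hEx.2 hkids
          (c' + P'.invokeCost (f s) (buf.map (Entry.conv f)).length + P'.psi.cost (f s))
        rw [← H.out_eq s hEx.1] at e₁
        have hfind' : (buf.map (Entry.conv f)).find? (fun e => e.key = P'.key (f s)) = none := by
          rw [hconv _ hsInv, hfind]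
          rfl
        have hrun' := P'.exec_of_find?_eq_none n hfind' e₁
        rw [hus, H.phi_eq, H.cmps_eq, ← H.res_eq s hs, H.key_eq s hsInv] at hrun'
        have hk : P'.kids (f s) = (P.kids s).map f := by
          rw [Prog.kids, H.out_eq s hEx.1, Prog.kids, List.flatMap_map, List.map_flatMap]
          exact List.flatMap_congr fun t _ => Func.comps_map f t
        refine ⟨_, (f s, keySet buf) :: (log ++ []), hrun', ?_, ?_, ?_, fun E hE => ?_⟩
        · refine .miss ?_ (hk ▸ e₂) ?_
          · rw [H.key_eq s hsInv, mem_keySet]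
            rintro ⟨e, he, hek⟩
            exact absurd (List.find?_eq_none.1 hfind e he) (by simp [hek])
          · have : keySet (⟨s, P.key s, res s⟩ :: new ++ buf) =
                insert (P'.key (f s)) (keySet (new ++ buf)) := by
              simp [keySet, H.key_eq s hsInv]
            rw [this]
            exact .nil _
        · simp [e₃]
        · simp only [List.append_nil, List.mem_cons, forall_eq_or_imp]
          exact ⟨⟨s, hs, rfl⟩, e₄⟩
        · have h₁ := hinvoke buf E (by simp only [List.length_append] at hE; omega)
          have h₂ := H.psi_cost_le s hs hEx.1
          have h₃ := H.combine_cost_le s hs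
          have h₄ := e₅ E (by simp only [List.length_append, List.length_cons] at hE ⊢; omega)
          have h₅ := Nat.mul_le_mul_right (invokeBound P' cKey E) (H.length_kids_le s hs)
          simp only [List.length_cons, List.length_nil, add_mul, one_mul, zero_add]
          have h₆ : expandBound P' cKey cPsi cComb nKids E =
            cPsi + cComb + nKids * invokeBound P' cKey E := rfl
          omega

end

/-! ### Pseudo-polynomial bounds -/

theorem PolyGrowth.polyBounded {α : Type} {p : ℕ → ℕ} (hp : PolyGrowth p) {T b n w : α → ℕ}
    (hb : PolyBounded b n w) (h : ∀ a, T a ≤ p (b a)) : PolyBounded T n w := by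
  obtain ⟨c, k, hb⟩ := hb
  obtain ⟨d, l, hd⟩ := (hp.comp ((PolyGrowth.const c).mul ((PolyGrowth.id.add (.const 1)).pow k))).2
  exact ⟨d, l, fun a => ((h a).trans (hp.1 (hb a))).trans (hd _)⟩

theorem PolyBounded.add_inputs {α : Type} {b n w : α → ℕ} (hb : PolyBounded b n w) :
    PolyBounded (fun a => b a + n a + w a) n w := by
  obtain ⟨c, k, hb⟩ := hb
  obtain ⟨d, l, hd⟩ :=
    (((PolyGrowth.const c).mul ((PolyGrowth.id.add (.const 1)).pow k)).add .id).2
  refine ⟨d, l, fun a => le_trans ?_ (hd (n a + w a))⟩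
  have := hb a
  show b a + n a + w a ≤ c * (n a + w a + 1) ^ k + (n a + w a)
  omega

theorem Stmt.PseudoPolyTime.exists_polyGrowth {σ ρ : Ty} {s : Stmt σ ρ []} (h : s.PseudoPolyTime) :
    ∃ p, PolyGrowth p ∧ ∀ (b : ℕ) (x : σ.El), Fits b σ x → s.cost x ≤ p b := by
  obtain ⟨c, k, h⟩ := h
  have hp : PolyGrowth fun b => c * (b + b + 1) ^ k :=
    (PolyGrowth.const c).mul (((PolyGrowth.id.add .id).add (.const 1)).pow k)
  refine ⟨_, hp, fun b x hx => (h x).trans ?_⟩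
  have h1 := hx.1
  have h2 := hx.2
  gcongr

theorem exists_polyGrowth_sum_cost_le {σ τ : Ty} {l : List (Expr σ [] τ)}
    (h : ∀ e ∈ l, e.PolyCost) :
    ∃ p, PolyGrowth p ∧ ∀ (b : ℕ) (x : σ.El), Fits b σ x →
      (l.map fun e => e.cost x ()).sum ≤ p b := by
  induction l with
  | nil => exact ⟨_, .const 0, by simp⟩
  | cons e l ih =>
    simp only [List.mem_cons, forall_eq_or_imp] at h
    obtain ⟨p, hp, h₁⟩ := h.1
    obtain ⟨q, hq, h₂⟩ := ih h.2
    refine ⟨_, hp.add hq, fun b x hx => ?_⟩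
    rw [List.map_cons, List.sum_cons]
    exact Nat.add_le_add (h₁ b x () hx (.nil b)) (h₂ b x hx)

theorem sum_map_le {α : Type} {l : List α} {g : α → ℕ} {N C : ℕ} (hl : l.length ≤ N)
    (h : ∀ x ∈ l, g x ≤ C) : (l.map g).sum ≤ N * C := by
  have := List.sum_le_card_nsmul (l.map g) C (by simpa using h)
  rw [List.length_map, smul_eq_mul] at this
  exact this.trans (Nat.mul_le_mul_right _ hl)

section

variable {F : Func} {A B : Ty}

/-- A common pseudo-polynomial bound on the states, the transitions, the partial solutions and the
temporary variables that occur in the run of a hylomorphism. -/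
theorem PseudoPolyValues.exists_bound {I : Set B.El} {φ : Stmt (F.app A) A []}
    {ψ : Stmt B (F.app B) []} (h : PseudoPolyValues I φ ψ) :
    ∃ b : I → ℕ, PolyBounded b (fun i => size B i) (fun i => mag B i) ∧
      ∀ i : I, ∀ s ∈ states F ψ.out i,
        Fits (b i) B s ∧ (∀ p ∈ ψ.evaluated s, p.t.Fits (b i)) ∧
        (∀ t ∈ ψ.out s, Fits (b i) (F.app B) t) ∧
        ∀ u ∈ phiInputs F id φ.out ψ.out s,
          (∀ p ∈ φ.evaluated u, p.t.Fits (b i)) ∧ ∀ p ∈ φ.out u, Fits (b i) A p := by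
  obtain ⟨b, hb, h⟩ := h
  refine ⟨_, hb.add_inputs, fun i => ?_⟩
  have hout : ∀ s ∈ states F ψ.out i, ∀ t ∈ ψ.out s,
      Fits (b i + size B i + mag B i) (F.app B) t := by
    intro s hs t ht
    obtain ⟨Γ, e, t', hp, rfl⟩ := Stmt.exists_evaluated ht
    have h₁ := (h i s hs).1 _ hp
    dsimp only at h₁
    exact ⟨by omega, by omega⟩
  intro s hs
  refine ⟨?_, fun p hp => ?_, hout s hs, fun u hu => ⟨fun p hp => ?_, fun p hp => ?_⟩⟩
  · rcases Relation.ReflTransGen.cases_tail hs with rfl | ⟨s', hs', t, ht, hst⟩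
    · exact ⟨by omega, by omega⟩
    · exact Func.fits_of_mem_comps (hout s' hs' t ht) hst
  · have h₁ := (h i s hs).1 p hp
    exact ⟨by omega, by omega⟩
  · have h₁ := (h i s hs).2 u hu p hp
    exact ⟨by omega, by omega⟩
  · obtain ⟨Γ, e, t', he, rfl⟩ := Stmt.exists_evaluated hp
    have h₁ := (h i s hs).2 u hu _ he
    dsimp only at h₁
    exact ⟨by omega, by omega⟩

/-! ### The two changes of representation -/

/-- The comparisons in `R'` have the same keys on the image of `p` as those in `R` on `p`. -/
def SameKeys {A' : Ty} (R : List (Cmp A)) (R' : List (Cmp A')) (g : A.El → A'.El) (p : A.El) :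
    Prop :=
  List.Forall₂ (fun c c' => c'.le = c.le ∧ c'.key.val (g p) () = c.key.val p ()) R R'

theorem SameKeys.keyVec_eq {A' : Ty} {R : List (Cmp A)} {R' : List (Cmp A')} {g : A.El → A'.El}
    {p : A.El} (h : SameKeys R R' g p) : keyVec R' (g p) = keyVec R p := by
  unfold SameKeys at h
  induction h with
  | nil => rfl
  | cons h _ ih =>
    simp only [keyVec, List.map_cons, h.2] at ih ⊢
    rw [ih]

theorem SameKeys.dominated_eq {A' : Ty} {R : List (Cmp A)} {R' : List (Cmp A')} {g : A.El → A'.El}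
    {p q : A.El} (h : SameKeys R R' g p) (h' : SameKeys R R' g q) :
    dominated R' (g p) (g q) = dominated R p q := by
  unfold SameKeys at h h'
  induction h with
  | nil => rfl
  | cons h _ ih =>
    cases h' with
    | cons h' hs' =>
      simp only [dominated, List.all_cons] at ih ⊢
      rw [ih hs', Cmp.holds, Cmp.holds, h.1, h.2, h'.2]

/-- Both cases of the second step convert partial solutions by a function `g`, which is the identity
if nothing is changed. -/
theorem Step2.exists_conv {G : Grammar} {I : Set B.El} {φ : Stmt (F.app A) A []}
    {ψ : Stmt B (F.app B) []} {o : Expr A [] .int} {R : List (Cmp A)} {A' : Ty}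
    {φ' : Stmt (F.app A') A' []} {o' : Expr A' [] .int} {R' : List (Cmp A')}
    (h : Step2 G I φ ψ o R A' φ' o' R')
    (hG : ∀ ⦃σ : Ty⦄ ⦃Γ : List Ty⦄ ⦃τ : Ty⦄ (e : Expr σ Γ τ), G e → e.PolyCost)
    (hlin : ∀ ⦃σ : Ty⦄ ⦃Γ : List Ty⦄ ⦃τ : Ty⦄ (e : Expr σ Γ τ), G e → e.LinearOps)
    (ho : A.isFlat = true → o.PolyCost) (hR : ∀ c ∈ R, c = ⟨true, o⟩ ∨ G c.key) :
    ∃ g : A.El → A'.El, A'.isFlat = true ∧ o'.PolyCost ∧ (∀ c ∈ R', c.key.PolyCost) ∧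
      (∃ p, PolyGrowth p ∧ ∀ b x, Fits b A x → Fits (p b) A' (g x)) ∧
      ∃ Q, PolyGrowth Q ∧ ∀ i ∈ I, ∀ s ∈ states F ψ.out i,
        ∀ u ∈ phiInputs F (fun S => (thin R S).1) φ.out ψ.out s,
          φ'.out (F.map g u) = (φ.out u).map g ∧
          (∀ p ∈ φ.out u, SameKeys R R' g p) ∧
          ∀ b, Fits b (F.app A') (F.map g u) → (∀ p ∈ φ.evaluated u, p.t.Fits b) →
            φ'.cost (F.map g u) ≤ Q b * φ.cost u := by
  cases h with
  | skip hA =>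
    refine ⟨fun p => p, hA, ho hA, fun c hc => ?_, ⟨_, .id, fun _ _ h => h⟩, _, .const 1,
      fun i _ s _ u _ => ⟨?_, fun p _ => ?_, fun b _ _ => ?_⟩⟩
    · rcases hR c hc with rfl | hc
      exacts [ho hA, hG _ hc]
    · rw [Func.map_id, List.map_id']
    · exact List.forall₂_same.2 fun _ _ => ⟨rfl, rfl⟩
    · rw [Func.map_id, one_mul]
  | incr hA _ hA' fp hfp q c k hφ hk hko hspec =>
    have hφ' := hφ.mono (Q' := fun _ _ e => e.PolyCost) (C' := fun _ e => e.PolyCost)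
      (fun _ _ e he => hG e he) fun _ e he => hG e he
    obtain ⟨p, hp, hfp'⟩ := (hG fp hfp).exists_fits_val (hlin fp hfp)
    obtain ⟨Q, hQ, hQ'⟩ := hφ'.exists_cost_le (F.map fun p => fp.val p ()) fun p => fp.val p ()
    refine ⟨fun p => fp.val p (), Ty.isFlat_of_isScalar hA', hG _ hko, fun c' hc' => ?_,
      ⟨p, hp, fun b x hx => hfp' b x () hx (.nil b)⟩, Q, hQ,
      fun i hi s hs u hu => ⟨(hspec i hi s hs u hu).1.out_eq hφ', fun p hp => ?_,
        fun b hb hb' => hQ' b u hb (hspec i hi s hs u hu).1 hb'⟩⟩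
    · obtain ⟨y, hy, rfl⟩ := List.mem_map.1 hc'
      exact hG _ (hk y hy)
    · exact List.forall₂_map_right_iff.2 (List.forall₂_same.2 fun y hy =>
        ⟨rfl, (((hspec i hi s hs u hu).2 p hp).2 y hy).symm⟩)

/-- Both cases of the fourth step convert states by the program that converts the instance. -/
theorem Step4.exists_bounds {G : Grammar} {I : Set B.El} {P : Prog F B A} {B' : Ty}
    {P' : Prog F B' A} {fs : Expr B [] B'} (h : Step4 G I P B' P' fs)
    (hG : ∀ ⦃σ : Ty⦄ ⦃Γ : List Ty⦄ ⦃τ : Ty⦄ (e : Expr σ Γ τ), G e → e.PolyCost)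
    (hlin : ∀ ⦃σ : Ty⦄ ⦃Γ : List Ty⦄ ⦃τ : Ty⦄ (e : Expr σ Γ τ), G e → e.LinearOps)
    (hK : ∀ k ∈ P.keys, G k) :
    B'.isFlat = true ∧ P'.phi = P.phi ∧ P'.cmps = P.cmps ∧ P'.obj = P.obj ∧ fs.PolyCost ∧
      (∀ k ∈ P'.keys, k.PolyCost) ∧
      (∃ p, PolyGrowth p ∧ ∀ b x, Fits b B x → Fits (p b) B' (fs.val x ())) ∧
      ∃ Q, PolyGrowth Q ∧ ∀ i ∈ I,
        (∀ s ∈ P.expanded i,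
          P'.psi.out (fs.val s ()) = (P.psi.out s).map (F.map fun s => fs.val s ()) ∧
          ∀ b, Fits b B' (fs.val s ()) → (∀ p ∈ P.psi.evaluated s, p.t.Fits b) →
            P'.psi.cost (fs.val s ()) ≤ Q b * P.psi.cost s) ∧
        ∀ s ∈ P.invoked i, P'.key (fs.val s ()) = P.key s := by
  cases h with
  | skip hB =>
    refine ⟨hB, rfl, rfl, rfl, ⟨_, .const 1, fun _ _ _ _ _ => le_rfl⟩, fun k hk => hG k (hK k hk),
      ⟨_, .id, fun _ _ h => h⟩, _, .const 1, fun i _ => ⟨fun s _ => ⟨?_, fun b _ _ => ?_⟩,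
        fun _ _ => rfl⟩⟩
    · have : F.map (fun s : B.El => (Expr.inp : Expr B [] B).val s ()) = fun t => t :=
        funext fun t => Func.map_id t
      rw [this, List.map_id']
      rfl
    · rw [one_mul]
      rfl
  | incr hB _ hB' _ hfs q c k hψ hk hspec =>
    have hψ' := hψ.mono (Q' := fun _ _ e => e.PolyCost) (C' := fun _ e => e.PolyCost)
      (fun _ _ e he => hG e he) fun _ e he => he.polyCost hG
    obtain ⟨p, hp, hfs'⟩ := (hG fs hfs).exists_fits_val (hlin fs hfs)
    obtain ⟨Q, hQ, hQ'⟩ := hψ'.exists_cost_le (fun s => fs.val s ()) (F.map fun s => fs.val s ())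
    refine ⟨Ty.isFlat_of_isScalar hB', rfl, rfl, rfl, hG fs hfs, fun k' hk' => ?_,
      ⟨p, hp, fun b x hx => hfs' b x () hx (.nil b)⟩, Q, hQ,
      fun i hi => ⟨fun s hs => ⟨((hspec i hi).1 s hs).out_eq hψ', fun b hb hb' =>
        hQ' b s hb ((hspec i hi).1 s hs) hb'⟩, fun s hs => ?_⟩⟩
    · obtain ⟨y, hy, rfl⟩ := List.mem_map.1 hk'
      exact hG _ (hk y hy)
    · simp only [Prog.key, List.map_map]
      exact List.map_congr_left fun y hy => ((hspec i hi).2 s hs y hy).symm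

end

/-! ### The run of the synthesized program -/

section

variable {F : Func} {A A' B B' : Ty}

theorem Prog.combineCost_le (P : Prog F B A) {us : List (F.app A).El} {N W C cKey : ℕ}
    (hN : us.length ≤ N) (h : ∀ u ∈ us, size (F.app A) u ≤ W ∧ P.phi.cost u ≤ C ∧
      ∀ p ∈ P.phi.out u, (P.cmps.map fun c => c.key.cost p ()).sum ≤ cKey) :
    P.combineCost us ≤ N * (W + C) +
      (1 + N * C * (cKey + 3 * (N * C + 1) * (P.cmps.length + 1))) + 1 := by
  have h₁ : (us.map fun u => size (F.app A) u + P.phi.cost u).sum ≤ N * (W + C) :=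
    sum_map_le hN fun u hu => Nat.add_le_add (h u hu).1 (h u hu).2.1
  have h₂ : (us.flatMap P.phi.out).length ≤ N * C := by
    rw [List.length_flatMap]
    exact sum_map_le hN fun u hu => (P.phi.length_eval_le u ()).trans (h u hu).2.1
  have h₃ : (thin P.cmps (us.flatMap P.phi.out)).2 ≤
      1 + N * C * (cKey + 3 * (N * C + 1) * (P.cmps.length + 1)) := by
    refine (cost_thin_le (C := cKey) fun p hp => ?_).trans (by gcongr)
    obtain ⟨u, hu, hp⟩ := List.mem_flatMap.1 hp
    exact (h u hu).2.2 p hp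
  unfold Prog.combineCost
  omega

/-- The number of expansions is at most quadratic in the number of converted states. -/
theorem Simulates.exists_exec_eq {P : Prog F B A} {P' : Prog F B' A} {f : B.El → B'.El}
    {res : B.El → List A.El} {S : Set B.El} {i : B.El} {cKey cPsi cComb nKids : ℕ}
    (H : Simulates P P' f res S (P.expanded i) (P.invoked i) cKey cPsi cComb nKids) (hi : i ∈ S)
    {n : ℕ} (hn : Terminates F P.psi.out n i) {X : Finset B'.El} (hX : ∀ s ∈ S, f s ∈ X) (c : ℕ) :
    ∃ buf c', (P'.exec n (f i)).run ([], c) = some (res i, (buf, c')) ∧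
      c' ≤ c + invokeBound P' cKey (X.card * (X.card + 1)) +
        X.card * (X.card + 1) *
          expandBound P' cKey cPsi cComb nKids (X.card * (X.card + 1)) := by
  obtain ⟨new, c₁, hrun, _, h⟩ := H.sim hi hn [] 0 (by simp [GoodBuffer])
  rw [List.append_nil] at hrun h
  obtain ⟨c', log, hrun', hdfs, hlog, hmem, hc⟩ := h
    (fun e he => ⟨n, _, _, hrun, e, he, rfl⟩)
    (fun s hs => Or.inl (List.mem_singleton.1 hs)) c
  have hE : new.length ≤ X.card * (X.card + 1) := by
    rw [← hlog]
    refine hdfs.length_log_le fun y hy => ?_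
    obtain ⟨s, hs, hsy⟩ := hmem y hy
    exact hsy ▸ hX s hs
  refine ⟨_, c', hrun', (hc _ hE).trans ?_⟩
  rw [List.length_singleton, one_mul]
  gcongr

variable {φ : Stmt (F.app A) A []} {ψ : Stmt B (F.app B) []} {φ' : Stmt (F.app A') A' []}
  {R : List (Cmp A)} {R' : List (Cmp A')} {g : A.El → A'.El}

theorem flatMap_car_map_map (r : B.El → List A.El) (l : List (F.app B).El) :
    (l.flatMap fun t => F.car (a := A') (F.map (b := .list A') (fun s => (r s).map g) t)) =
      (l.flatMap fun t => F.car (a := A) (F.map (b := .list A) r t)).map (F.map g) := by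
  rw [List.map_flatMap]
  refine List.flatMap_congr fun t _ => ?_
  rw [← Func.car_map]
  exact congrArg _ (Func.map_map (b := .list A) (c := .list A') r (List.map g) t).symm

/-- The thinned recursion on converted partial solutions computes the converted results of the
original thinned recursion, including their order. -/
theorem gen_thin_map {i : B.El}
    (H : ∀ s ∈ states F ψ.out i, ∀ u ∈ phiInputs F (fun S => (thin R S).1) φ.out ψ.out s,
      φ'.out (F.map g u) = (φ.out u).map g ∧ ∀ p ∈ φ.out u, SameKeys R R' g p)
    {n : ℕ} {s : B.El} (hs : s ∈ states F ψ.out i) (hn : Terminates F ψ.out n s) :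
    gen F (fun S => (thin R' S).1) φ'.out ψ.out n s =
      (gen F (fun S => (thin R S).1) φ.out ψ.out n s).map g := by
  induction n generalizing s with
  | zero => exact hn.elim
  | succ n ih =>
    have hus : ((ψ.out s).flatMap fun t => F.car (a := A') (F.map (b := .list A')
          (gen F (fun S => (thin R' S).1) φ'.out ψ.out n) t)) =
        ((ψ.out s).flatMap fun t => F.car (a := A) (F.map (b := .list A)
          (gen F (fun S => (thin R S).1) φ.out ψ.out n) t)).map (F.map g) := by
      rw [← flatMap_car_map_map]
      refine List.flatMap_congr fun t ht => congrArg _ (Func.map_congr fun s' hs' => ?_)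
      exact ih (Relation.ReflTransGen.tail hs ⟨t, ht, hs'⟩) (hn s' ⟨t, ht, hs'⟩)
    have hmem : ∀ u ∈ (ψ.out s).flatMap fun t => F.car (a := A) (F.map (b := .list A)
          (gen F (fun S => (thin R S).1) φ.out ψ.out n) t),
        u ∈ phiInputs F (fun S => (thin R S).1) φ.out ψ.out s := by
      intro u hu
      obtain ⟨t, ht, hu⟩ := List.mem_flatMap.1 hu
      exact mem_phiInputs hn ht hu
    simp only [gen]
    rw [hus, List.flatMap_map]
    have hout : ∀ us : List (F.app A).El,
        (∀ u ∈ us, u ∈ phiInputs F (fun S => (thin R S).1) φ.out ψ.out s) →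
        us.flatMap (fun u => φ'.out (F.map g u)) = (us.flatMap φ.out).map g := by
      intro us hus
      rw [List.map_flatMap]
      exact List.flatMap_congr fun u hu => (H s hs u (hus u hu)).1
    rw [hout _ hmem]
    have hkeys : ∀ p ∈ ((ψ.out s).flatMap fun t => F.car (a := A) (F.map (b := .list A)
        (gen F (fun S => (thin R S).1) φ.out ψ.out n) t)).flatMap φ.out, SameKeys R R' g p := by
      intro p hp
      obtain ⟨u, hu, hp⟩ := List.mem_flatMap.1 hp
      exact (H s hs u (hmem u hu)).2 p hp
    exact thin_map g (fun p hp q hq => (hkeys p hp).dominated_eq (hkeys q hq))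
      fun p hp => (hkeys p hp).keyVec_eq

end

end MetHyl

theorem mainTheorem8 (F : Func) (A B : Ty)
    (φ : Stmt (F.app A) A []) (ψ : Stmt B (F.app B) []) (o : Expr A [] .int)
    (G : Grammar) (I : Set B.El) (O : Output F B)
    (hO : Synthesized G I φ ψ o O)
    (hterm : ∀ i ∈ I, ∃ n L, hylo F φ ψ n i = some L)
    (hφ : φ.PseudoPolyTime) (hψ : ψ.PseudoPolyTime)
    (ho : A.isFlat = true → o.PseudoPolyTime)
    (hG : ∀ ⦃σ : Ty⦄ ⦃Γ : List Ty⦄ ⦃τ : Ty⦄ (e : Expr σ Γ τ), G e → e.PseudoPolyTime)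
    (hvals : PseudoPolyValues I φ ψ)
    (hlin : ∀ ⦃σ : Ty⦄ ⦃Γ : List Ty⦄ ⦃τ : Ty⦄ (e : Expr σ Γ τ), G e → e.LinearOps) :
    O.RunsInPseudoPolyTime I := by
  obtain ⟨R, φ', o', R', K, h₁, h₂, h₃, h₄⟩ := hO
  have hGc : ∀ ⦃σ : Ty⦄ ⦃Γ : List Ty⦄ ⦃τ : Ty⦄ (e : Expr σ Γ τ), G e → e.PolyCost :=
    fun _ _ _ e he => (hG e he).polyCost
  obtain ⟨g, hA', ho', hR', ⟨pg, hpg, hg⟩, Q, hQ, hstep2⟩ :=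
    h₂.exists_conv hGc hlin (fun h => (ho h).polyCost) h₁.2.1
  obtain ⟨hB', hphi, hcmps, hobj, hconv, hkeys, ⟨pf, hpf, hf⟩, Q', hQ', hstep4⟩ :=
    h₄.exists_bounds hGc hlin h₃.1
  dsimp only at hphi hcmps hobj
  obtain ⟨b, hb, hbound⟩ := hvals.exists_bound
  obtain ⟨pφ, hpφ, hφ⟩ := hφ.exists_polyGrowth
  obtain ⟨pψ, hpψ, hψ⟩ := hψ.exists_polyGrowth
  obtain ⟨pA, hpA, hcardA⟩ := exists_polyGrowth_card_of_isFlat hA'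
  obtain ⟨pB, hpB, hcardB⟩ := exists_polyGrowth_card_of_isFlat hB'
  obtain ⟨pK, hpK, hcostK⟩ := exists_polyGrowth_sum_cost_le hkeys
  obtain ⟨pR, hpR, hcostR⟩ := exists_polyGrowth_sum_cost_le (l := R'.map Cmp.key) (by
    intro e he
    obtain ⟨c, hc, rfl⟩ := List.mem_map.1 he
    exact hR' c hc)
  simp only [List.map_map] at hcostR
  obtain ⟨po, hpo, hcosto⟩ := ho'
  obtain ⟨pc, hpc, hcostc⟩ := hconv
  -- Bounds in terms of `x = b i`: `W` and `W₀` on the inputs of `φ'` and `φ`, `C` on the steps of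
  -- `φ'` on one input, `N` on the number of inputs of `φ'` in one expansion, `D` on the steps that
  -- combine results in one expansion, `E` on the number of expansions, `V` on the steps of one
  -- invocation, and `X` on those of one expansion with the invocations it makes.
  let W : ℕ → ℕ := fun x => (x + F.arity * pg x) + (x + pg x)
  let W₀ : ℕ → ℕ := fun x => (x + F.arity * x) + (x + x)
  let C : ℕ → ℕ := fun x => Q (W x) * pφ (W₀ x)
  let N : ℕ → ℕ := fun x => pψ x * (pA (pg x) + 1) ^ F.arity
  let D : ℕ → ℕ := fun x => N x * (W x + C x) +
    (1 + N x * C x * (pR (pg x) + 3 * (N x * C x + 1) * (R'.length + 1))) + 1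
  let E : ℕ → ℕ := fun x => pB (pf x) * (pB (pf x) + 1)
  let V : ℕ → ℕ := fun x => 1 + pK (pf x) + (E x + 1) * (O.prog.keys.length + 1)
  let X : ℕ → ℕ := fun x => Q' (x + pf x) * pψ x + D x + pψ x * F.arity * V x
  have hW : PolyGrowth W := (PolyGrowth.id.add ((PolyGrowth.const _).mul hpg)).add
    (PolyGrowth.id.add hpg)
  have hW₀ : PolyGrowth W₀ := (PolyGrowth.id.add ((PolyGrowth.const _).mul .id)).add
    (PolyGrowth.id.add .id)
  have hC : PolyGrowth C := (hQ.comp hW).mul (hpφ.comp hW₀)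
  have hN : PolyGrowth N := hpψ.mul (((hpA.comp hpg).add (.const 1)).pow _)
  have hD : PolyGrowth D := ((hN.mul (hW.add hC)).add ((PolyGrowth.const 1).add ((hN.mul hC).mul
    ((hpR.comp hpg).add (((PolyGrowth.const 3).mul ((hN.mul hC).add (.const 1))).mul
      (.const _)))))).add (.const 1)
  have hE : PolyGrowth E := (hpB.comp hpf).mul ((hpB.comp hpf).add (.const 1))
  have hV : PolyGrowth V := ((PolyGrowth.const 1).add (hpK.comp hpf)).add
    ((hE.add (.const 1)).mul (.const _))
  have hX : PolyGrowth X := (((hQ'.comp (PolyGrowth.id.add hpf)).mul hpψ).add hD).add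
    ((hpψ.mul (.const _)).mul hV)
  have htotal : PolyGrowth fun x => (pc x + V x + E x * X x) + pA (pg x) * (po (pg x) + 1) + 1 :=
    (((hpc.add hV).add (hE.mul hX)).add ((hpA.comp hpg).mul ((hpo.comp hpg).add (.const 1)))).add
      (.const 1)
  suffices h : ∀ i : I, ∃ T n v, O.run n i = some (v, T) ∧
      T ≤ (pc (b i) + V (b i) + E (b i) * X (b i)) + pA (pg (b i)) * (po (pg (b i)) + 1) + 1 by
    choose T n v hT hle using h
    exact ⟨T, htotal.polyBounded hb hle, fun i => ⟨n i, v i, hT i⟩⟩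
  intro i
  obtain ⟨n, L, hL⟩ := hterm i i.2
  have hn : Terminates F ψ.out n i := terminates_of_rg_eq_some hL
  have hi : (i : B.El) ∈ states F ψ.out i := Relation.ReflTransGen.refl
  have hns : ∀ s ∈ states F ψ.out i, Terminates F ψ.out n s := fun s hs => hn.of_mem_states hs
  have hkid : ∀ s ∈ states F ψ.out i, ∀ s', Child F ψ.out s s' → s' ∈ states F ψ.out i :=
    fun s hs s' hs' => Relation.ReflTransGen.tail hs hs'
  let res₀ := gen F (fun S => (thin R S).1) φ.out ψ.out n
  let res := gen F (fun S => (thin R' S).1) φ'.out ψ.out n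
  -- the results of the thinned recursion are results of the hylomorphism, hence bounded
  have hsub : ∀ s, res₀ s ⊆ gen F id φ.out ψ.out n s :=
    gen_subset (fun S => thin_subset S) (fun S => List.Subset.refl S) n
  have hin : ∀ s ∈ states F ψ.out i, ∀ t ∈ ψ.out s,
      ∀ u ∈ F.car (a := A) (F.map (b := .list A) res₀ t),
        u ∈ phiInputs F (fun S => (thin R S).1) φ.out ψ.out s ∧
        u ∈ phiInputs F id φ.out ψ.out s := by
    intro s hs t ht u hu
    have hk : ∀ s', Child F ψ.out s s' → Terminates F ψ.out n s' :=
      fun s' hs' => hns s' (hkid s hs s' hs')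
    exact ⟨mem_phiInputs hk ht hu,
      mem_phiInputs hk ht (Func.car_map_subset (fun s' _ => hsub s') hu)⟩
  have hfit₀ : ∀ s ∈ states F ψ.out i, ∀ p ∈ res₀ s, Fits (b i) A p := by
    intro s hs p hp
    have hp' := hsub s hp
    rw [(hns s hs).gen_eq] at hp'
    obtain ⟨u, hu, hp'⟩ := List.mem_flatMap.1 hp'
    obtain ⟨t, ht, hu⟩ := List.mem_flatMap.1 hu
    exact ((hbound i s hs).2.2.2 u (mem_phiInputs
      (fun s' hs' => hns s' (hkid s hs s' hs')) ht hu)).2 p hp'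
  have hres : ∀ s ∈ states F ψ.out i, res s = (res₀ s).map g := fun s hs =>
    gen_thin_map (fun s hs u hu => ⟨(hstep2 i i.2 s hs u hu).1, (hstep2 i i.2 s hs u hu).2.1⟩)
      hs (hns s hs)
  have hfit : ∀ s ∈ states F ψ.out i, ∀ p ∈ res s, Fits (pg (b i)) O.A' p := by
    intro s hs p hp
    rw [hres s hs] at hp
    obtain ⟨p₀, hp₀, rfl⟩ := List.mem_map.1 hp
    exact hg _ p₀ (hfit₀ s hs p₀ hp₀)
  have hlen : ∀ s ∈ states F ψ.out i, (res s).length ≤ pA (pg (b i)) := by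
    intro s hs
    obtain ⟨Z, hZ, hZ'⟩ := hcardA (pg (b i))
    have hnd : (res s).Nodup := by
      dsimp only [res]
      rw [(hns s hs).gen_eq]
      exact nodup_thin _
    classical
    rw [← List.toFinset_card_of_nodup hnd]
    exact (Finset.card_le_card fun p hp =>
      hZ p (hfit s hs p (List.mem_toFinset.1 hp)).2).trans hZ'
  have hus : ∀ s ∈ states F ψ.out i,
      ((ψ.out s).flatMap fun t => F.car (a := O.A') (F.map (b := .list O.A') res t)) =
        ((ψ.out s).flatMap fun t => F.car (a := A) (F.map (b := .list A) res₀ t)).map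
          (F.map g) := by
    intro s hs
    rw [← flatMap_car_map_map]
    exact List.flatMap_congr fun t ht => congrArg _ (Func.map_congr fun s' hs' =>
      hres s' (hkid s hs s' ⟨t, ht, hs'⟩))
  have hout : ∀ s ∈ states F ψ.out i, (ψ.out s).length ≤ pψ (b i) := fun s hs =>
    (ψ.length_eval_le s ()).trans (hψ _ s (hbound i s hs).1)
  have hcomb : ∀ s ∈ states F ψ.out i, O.prog.combineCost ((ψ.out s).flatMap fun t =>
      F.car (a := O.A') (F.map (b := .list O.A') res t)) ≤ D (b i) := by
    intro s hs
    have hR'' : R'.length = O.prog.cmps.length := by rw [hcmps]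
    dsimp only [D]
    rw [hR'']
    refine O.prog.combineCost_le ?_ fun u' hu' => ?_
    · rw [List.length_flatMap]
      exact sum_map_le (hout s hs) fun t ht => Func.length_car_map_le fun s' hs' =>
        hlen s' (hkid s hs s' ⟨t, ht, hs'⟩)
    · have hsize : Fits (W (b i)) (F.app O.A') u' := by
        obtain ⟨t, ht, hu'⟩ := List.mem_flatMap.1 hu'
        have ht' := (hbound i s hs).2.2.1 t ht
        have := Func.fits_of_mem_car_map ht'.1 ht'.2
          (fun s' hs' => hfit s' (hkid s hs s' ⟨t, ht, hs'⟩)) hu'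
        exact ⟨this.1.trans (Nat.le_add_right _ _), this.2.trans (Nat.le_add_left _ _)⟩
      rw [hus s hs] at hu'
      obtain ⟨u, hu, rfl⟩ := List.mem_map.1 hu'
      obtain ⟨t, ht, hu⟩ := List.mem_flatMap.1 hu
      have hsize₀ : Fits (W₀ (b i)) (F.app A) u := by
        have ht' := (hbound i s hs).2.2.1 t ht
        have := Func.fits_of_mem_car_map ht'.1 ht'.2
          (fun s' hs' => hfit₀ s' (hkid s hs s' ⟨t, ht, hs'⟩)) hu
        exact ⟨this.1.trans (Nat.le_add_right _ _), this.2.trans (Nat.le_add_left _ _)⟩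
      obtain ⟨hu₁, hu₂⟩ := hin s hs t ht u hu
      obtain ⟨e₁, -, e₃⟩ := hstep2 i i.2 s hs u hu₁
      have hbu := (hbound i s hs).2.2.2 u hu₂
      have hbW : b i ≤ W (b i) := by
        dsimp only [W]
        omega
      refine ⟨hsize.1, ?_, fun p' hp' => ?_⟩
      · rw [hphi]
        refine (e₃ (W (b i)) hsize fun p hp => ?_).trans
          (Nat.mul_le_mul_left _ (hφ _ u hsize₀))
        exact ⟨(hbu.1 p hp).1.trans hbW, (hbu.1 p hp).2.trans hbW⟩
      · rw [hphi, e₁] at hp'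
        obtain ⟨p, hp, rfl⟩ := List.mem_map.1 hp'
        rw [hcmps]
        exact hcostR _ _ (hg _ p (hbu.2 p hp))
  have hfitB : ∀ s ∈ states F ψ.out i, Fits (pf (b i)) O.B' (O.conv.val s ()) :=
    fun s hs => hf _ s (hbound i s hs).1
  let P : Prog F B O.A' := { psi := ψ, phi := φ', cmps := R', obj := o', keys := K }
  have hsim : Simulates P O.prog (fun s => O.conv.val s ()) res (states F ψ.out i)
      (P.expanded i) (P.invoked i) (pK (pf (b i))) (Q' (b i + pf (b i)) * pψ (b i)) (D (b i))
      (pψ (b i) * F.arity) :=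
    { phi_eq := hphi
      cmps_eq := hcmps
      child_mem := hkid
      child_mem_inv := fun s hs s' hs' => Or.inr ⟨s, hs, hs'⟩
      res_eq := fun s hs => (hns s hs).gen_eq
      res_congr := by
        intro s hs s' hs' hkey
        have hmem := h₃.2 i i.2 s hs s' hs' (fun k hk => List.map_inj_left.1 hkey k hk) n n _ _
          (hns s hs).rg_eq (hns s' hs').rg_eq
        dsimp only [res]
        rw [(hns s hs).gen_eq, (hns s' hs').gen_eq] at hmem ⊢
        exact thin_eq_of_mem_iff hmem
      out_eq := fun s hs => ((hstep4 i i.2).1 s hs).1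
      key_eq := (hstep4 i i.2).2
      key_cost_le := fun s hs => hcostK _ _ (hfitB s hs)
      psi_cost_le := by
        intro s hs hs'
        refine (((hstep4 i i.2).1 s hs').2 (b i + pf (b i))
          ((hfitB s hs).mono (Nat.le_add_left _ _)) fun p hp => ?_).trans
          (Nat.mul_le_mul_left _ (hψ _ s (hbound i s hs).1))
        have := (hbound i s hs).2.1 p hp
        exact ⟨this.1.trans (Nat.le_add_right _ _), this.2.trans (Nat.le_add_right _ _)⟩
      combine_cost_le := hcomb
      length_kids_le := by
        intro s hs
        rw [Prog.kids, List.length_flatMap]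
        exact sum_map_le (hout s hs) fun t _ => Func.length_comps_le t }
  obtain ⟨Z, hZ, hZ'⟩ := hcardB (pf (b i))
  obtain ⟨buf, c', hrun, hc'⟩ := hsim.exists_exec_eq hi hn
    (fun s hs => hZ _ (hfitB s hs).2) (O.conv.cost (i : B.El) ())
  have hE' : Z.card * (Z.card + 1) ≤ E (b i) :=
    Nat.mul_le_mul hZ' (Nat.add_le_add_right hZ' 1)
  refine ⟨c' + ((res i).map fun p => O.prog.obj.cost p () + 1).sum + 1, n,
    ((res i).map fun p => O.prog.obj.val p ()).max?, ?_, ?_⟩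
  · have hrun' : O.prog.exec n (O.conv.val (i : B.El) ()) ([], O.conv.cost (i : B.El) ()) =
        some (res i, (buf, c')) := hrun
    rw [Output.run, hrun']
    rfl
  · have e₁ : c' ≤ pc (b i) + V (b i) + E (b i) * X (b i) := by
      refine hc'.trans (Nat.add_le_add (Nat.add_le_add
        (hcostc _ _ _ (hbound i i hi).1 (.nil _)) ?_) (Nat.mul_le_mul hE' ?_))
      · dsimp only [invokeBound, V]
        gcongr
      · dsimp only [expandBound, invokeBound, X, V]
        gcongr
    have e₂ : ((res i).map fun p => O.prog.obj.cost p () + 1).sum ≤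
        pA (pg (b i)) * (po (pg (b i)) + 1) := by
      refine sum_map_le (hlen i hi) fun p hp => ?_
      rw [hobj]
      exact Nat.add_le_add_right (hcosto _ p () (hfit i hi p hp) (.nil _)) 1
    omega
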